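/- Conventions. An operator system is a closed unital self-adjoint linear subspace $X$ of a unital $C^*$-algebra $A$; positivity in $M_n(X)=M_n\otimes X$ is positivity in the $C^*$-algebra $M_n(A)$; $X_{\mathrm{sa}}$ is the set of self-adjoint elements of $X$; and $\mathbb{N}=\{1,2,3,\dots\}$. A linear map $\varphi:X\to Y$ between operator systems is $n$-positive if $\mathrm{id}_n\otimes\varphi: M_n(X)\to M_n(Y)$ is positive, and completely positive if it is $n$-positive for all $n$. A unital $n$-order isomorphism is a unital linear bijection $\Phi:X\to Y$ such that $\Phi$ and $\Phi^{-1}$ are $m$-positive for $m=1,\dots,n$; it is a unital complete order isomorphism if $\Phi$ and $\Phi^{-1}$ are completely positive. A Lip-norm on an order-unit space $(V,e)$ is a seminorm $L$ on $V$ such that (1) $L(a)=0$ if and only if $a\in\mathbb{R}e$, and (2) the metric $\rho_L(\mu,\nu)=\sup\{|\mu(a)-\nu(a)|: a\in V,\ L(a)\le 1\}$ on the state space $S(V)$ induces the weak$^*$ topology. A Lip-norm $L$ is closed if $\{a\in V: L(a)\le 1\}$ is closed in the completion of $V$. A Lip-normed operator system is a pair $(X,L)$ in which $X$ is an operator system and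 $L$ is a Lip-norm on a dense order-unit subspace $\mathcal{D}(L)$ of $X_{\mathrm{sa}}$ such that $\mathcal{D}_1(L)=\{x\in\mathcal{D}(L): L(x)\le 1\}$ is closed in $X_{\mathrm{sa}}$. For Lip-normed operator systems $(X,L_X)$ and $(Y,L_Y)$, let $\mathcal{M}(L_X,L_Y)$ be the set of closed Lip-norms $L$ on $\mathcal{D}(L_X)\oplus\mathcal{D}(L_Y)\subseteq (X\oplus Y)_{\mathrm{sa}}$ which induce $L_X$ and $L_Y$ as quotient seminorms, i.e. $L_X(x)=\inf_{y\in\mathcal{D}(L_Y)}L(x,y)$ for all $x\in\mathcal{D}(L_X)$ and $L_Y(y)=\inf_{x\in\mathcal{D}(L_X)}L(x,y)$ for all $y\in\mathcal{D}(L_Y)$. Let $UCP_n(X)$ be the set of unital completely positive maps $X\to M_n(\mathbb{C})$. Regard $UCP_n(X)$ and $UCP_n(Y)$ as subsets of $UCP_n(X\oplus Y)$ by composing with the coordinate projections, and for $L\in\mathcal{M}(L_X,L_Y)$ let $\mathrm{dist}_H^{\rho_{L,n}}$ be the Hausdorff distance for the metric $$\rho_{L,n}(\varphi,\psi)=\sup_{z\in\mathcal{D}_1(L)}\|\varphi(z)-\psi(z)\|$$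 on $UCP_n(X\oplus Y)$. The $n$-distance and the complete distance are $$\mathrm{dist}^n_s(X,Y)=\inf_{L\in\mathcal{M}(L_X,L_Y)}\mathrm{dist}_H^{\rho_{L,n}}(UCP_n(X),UCP_n(Y)),$$ $$\mathrm{dist}_s(X,Y)=\inf_{L\in\mathcal{M}(L_X,L_Y)}\ \sup_{n\in\mathbb{N}}\ \mathrm{dist}_H^{\rho_{L,n}}(UCP_n(X),UCP_n(Y)).$$ A linear bijection $\Phi:X\to Y$ that is positive with positive inverse is bi-Lip-isometric if $\Phi(\mathcal{D}(L_X))\subseteq\mathcal{D}(L_Y)$ and $L_Y(\Phi(x))=L_X(x)$ for all $x\in\mathcal{D}(L_X)$, and likewise for $\Phi^{-1}$ with the roles of $X$ and $Y$ exchanged. Theorem. Let $(X,L_X)$ and $(Y,L_Y)$ be Lip-normed operator systems. (i) For every $n\in\mathbb{N}$, $\mathrm{dist}^n_s(X,Y)=0$ if and only if there is a bi-Lip-isometric unital $n$-order isomorphism from $X$ onto $Y$. (ii) $\mathrm{dist}_s(X,Y)=0$ if and only if there is a bi-Lip-isometric unital complete order isomorphism from $X$ onto $Y$. -/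

import Mathlib

open scoped ENNReal ComplexOrder

noncomputable section

/-! ### Operator systems, positivity of maps -/

/-- A (concrete) operator system: a closed unital self-adjoint linear subspace of a unital
C⋆-algebra. -/
structure OperatorSystem (A : Type*) [CStarAlgebra A] extends Submodule ℂ A where
  one_mem' : (1 : A) ∈ carrier
  star_mem' : ∀ {x : A}, x ∈ carrier → star x ∈ carrier
  isClosed' : IsClosed carrier

namespace OperatorSystem

/-- The unit of an operator system. -/
def unit {A : Type*} [CStarAlgebra A] (X : OperatorSystem A) : X.toSubmodule :=
  ⟨1, X.one_mem'⟩

/-- The direct sum `X ⊕ Y`, as an operator system in the C⋆-algebra `A × B`. -/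
def prod {A B : Type*} [CStarAlgebra A] [CStarAlgebra B]
    (X : OperatorSystem A) (Y : OperatorSystem B) : OperatorSystem (A × B) where
  toSubmodule := X.toSubmodule.prod Y.toSubmodule
  one_mem' := ⟨X.one_mem', Y.one_mem'⟩
  star_mem' := fun h => ⟨X.star_mem' h.1, Y.star_mem' h.2⟩
  isClosed' := X.isClosed'.prod Y.isClosed'

/-- The projection `X ⊕ Y → X`. -/
def fst {A B : Type*} [CStarAlgebra A] [CStarAlgebra B]
    (X : OperatorSystem A) (Y : OperatorSystem B) :
    (X.prod Y).toSubmodule →ₗ[ℂ] X.toSubmodule where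
  toFun z := ⟨z.1.1, z.2.1⟩
  map_add' _ _ := rfl
  map_smul' _ _ := rfl

/-- The projection `X ⊕ Y → Y`. -/
def snd {A B : Type*} [CStarAlgebra A] [CStarAlgebra B]
    (X : OperatorSystem A) (Y : OperatorSystem B) :
    (X.prod Y).toSubmodule →ₗ[ℂ] Y.toSubmodule where
  toFun z := ⟨z.1.2, z.2.2⟩
  map_add' _ _ := rfl
  map_smul' _ _ := rfl

end OperatorSystem

/-- A matrix with entries in the subspace `V ⊆ A`, seen as an element of the C⋆-algebra
`Mₙ(A)`; its positivity is positivity in that C⋆-algebra. -/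
def toCStarMatrix {A : Type*} [CStarAlgebra A] {V : Submodule ℂ A} {n : ℕ}
    (M : Matrix (Fin n) (Fin n) V) : CStarMatrix (Fin n) (Fin n) A :=
  CStarMatrix.ofMatrix (M.map fun x => (x : A))

/-- `φ : V → B` is `n`-positive: `id ⊗ φ` maps positive elements of `Mₙ(V)` to positive elements
of `Mₙ(B)`. -/
def IsNPositive {A B : Type*} [CStarAlgebra A] [PartialOrder A] [StarOrderedRing A]
    [CStarAlgebra B] [PartialOrder B] [StarOrderedRing B] {V : Submodule ℂ A}
    (n : ℕ) (φ : V →ₗ[ℂ] B) : Prop :=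
  ∀ M : Matrix (Fin n) (Fin n) V, 0 ≤ toCStarMatrix M →
    0 ≤ (CStarMatrix.ofMatrix (M.map fun x => φ x) : CStarMatrix (Fin n) (Fin n) B)

/-- Complete positivity. -/
def IsCP {A B : Type*} [CStarAlgebra A] [PartialOrder A] [StarOrderedRing A]
    [CStarAlgebra B] [PartialOrder B] [StarOrderedRing B] {V : Submodule ℂ A}
    (φ : V →ₗ[ℂ] B) : Prop :=
  ∀ n : ℕ, IsNPositive n φ

/-- A linear bijection `Φ : X → Y` is a unital `n`-order isomorphism: it is unital, and `Φ` and
its inverse are `m`-positive for `m = 1, …, n`. -/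
def IsUnitalNOrderIso {A B : Type*} [CStarAlgebra A] [PartialOrder A] [StarOrderedRing A]
    [CStarAlgebra B] [PartialOrder B] [StarOrderedRing B]
    (X : OperatorSystem A) (Y : OperatorSystem B) (n : ℕ)
    (Φ : X.toSubmodule ≃ₗ[ℂ] Y.toSubmodule) : Prop :=
  Φ X.unit = Y.unit ∧ ∀ m : ℕ, 1 ≤ m → m ≤ n →
    IsNPositive m (Y.toSubmodule.subtype ∘ₗ Φ.toLinearMap) ∧
    IsNPositive m (X.toSubmodule.subtype ∘ₗ Φ.symm.toLinearMap)

/-- A linear bijection `Φ : X → Y` is a unital complete order isomorphism: it is unital and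
completely positive with completely positive inverse. -/
def IsUnitalCompleteOrderIso {A B : Type*} [CStarAlgebra A] [PartialOrder A] [StarOrderedRing A]
    [CStarAlgebra B] [PartialOrder B] [StarOrderedRing B]
    (X : OperatorSystem A) (Y : OperatorSystem B)
    (Φ : X.toSubmodule ≃ₗ[ℂ] Y.toSubmodule) : Prop :=
  Φ X.unit = Y.unit ∧
    IsCP (Y.toSubmodule.subtype ∘ₗ Φ.toLinearMap) ∧
    IsCP (X.toSubmodule.subtype ∘ₗ Φ.symm.toLinearMap)

/-! ### Lip-norms on order-unit spaces -/

/-- The state space of an ordered real vector space `V` with order unit `e`: positive linear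
functionals with value `1` at `e`. -/
def OrderState (V : Type*) [AddCommGroup V] [Module ℝ V] [PartialOrder V] (e : V) : Type _ :=
  {μ : V →ₗ[ℝ] ℝ // (∀ a : V, 0 ≤ a → 0 ≤ μ a) ∧ μ e = 1}

/-- The weak⋆ topology on the state space: pointwise convergence on `V`. -/
@[reducible]
def OrderState.weakStar (V : Type*) [AddCommGroup V] [Module ℝ V] [PartialOrder V] (e : V) :
    TopologicalSpace (OrderState V e) :=
  TopologicalSpace.induced (fun μ (a : V) => μ.1 a) Pi.topologicalSpace

/-- `ρ_L(μ, ν) = sup { |μ a - ν a| : a ∈ V, L a ≤ 1 }`, with values in `[0, ∞]`. -/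
@[reducible]
def OrderState.lipMetric {V : Type*} [AddCommGroup V] [Module ℝ V] [PartialOrder V] (e : V)
    (L : Seminorm ℝ V) : PseudoEMetricSpace (OrderState V e) where
  edist μ ν := ⨆ (a : V) (_ : L a ≤ 1), ENNReal.ofReal |μ.1 a - ν.1 a|
  edist_self μ := by simp
  edist_comm μ ν := by simp only [abs_sub_comm]
  edist_triangle μ ν ω := by
    refine iSup₂_le fun a ha => ?_
    calc ENNReal.ofReal |μ.1 a - ω.1 a|
        ≤ ENNReal.ofReal (|μ.1 a - ν.1 a| + |ν.1 a - ω.1 a|) :=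
          ENNReal.ofReal_le_ofReal (abs_sub_le _ _ _)
      _ = ENNReal.ofReal |μ.1 a - ν.1 a| + ENNReal.ofReal |ν.1 a - ω.1 a| :=
          ENNReal.ofReal_add (abs_nonneg _) (abs_nonneg _)
      _ ≤ _ := add_le_add
          (le_iSup₂ (f := fun (a : V) (_ : L a ≤ 1) => ENNReal.ofReal |μ.1 a - ν.1 a|) a ha)
          (le_iSup₂ (f := fun (a : V) (_ : L a ≤ 1) => ENNReal.ofReal |ν.1 a - ω.1 a|) a ha)

/-- `L` is a Lip-norm on the order-unit space `(V, e)`. -/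
structure IsLipNorm {V : Type*} [AddCommGroup V] [Module ℝ V] [PartialOrder V] (e : V)
    (L : Seminorm ℝ V) : Prop where
  eq_zero_iff : ∀ a : V, L a = 0 ↔ ∃ r : ℝ, a = r • e
  induces_weakStar :
    (OrderState.lipMetric e L).toUniformSpace.toTopologicalSpace = OrderState.weakStar V e

/-! ### Lip-normed operator systems -/

/-- A Lip-normed operator system: an operator system `X` with a Lip-norm `lip` on a dense
order-unit subspace `dom` (a real linear subspace containing `1`, with the order of `A`) of the
self-adjoint part of `X`, such that `{x ∈ dom | lip x ≤ 1}` is closed. (As the self-adjoint part of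
`X` is closed in `A`, being closed in it and being closed in `A` are the same.) -/
structure LipNormedOperatorSystem (A : Type*) [CStarAlgebra A] [PartialOrder A]
    [StarOrderedRing A] extends OperatorSystem A where
  dom : Submodule ℝ A
  dom_le : ∀ x ∈ dom, x ∈ toSubmodule ∧ IsSelfAdjoint x
  one_mem_dom : (1 : A) ∈ dom
  dense_dom : ∀ x ∈ toSubmodule, IsSelfAdjoint x → x ∈ closure (dom : Set A)
  lip : Seminorm ℝ dom
  isLipNorm : IsLipNorm (⟨1, one_mem_dom⟩ : dom) lip
  isClosed_unitBall : IsClosed {x : A | ∃ hx : x ∈ dom, lip ⟨x, hx⟩ ≤ 1}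

/-- A map `Φ : X → Y` is Lip-isometric: it maps the domain of `L_X` into the domain of `L_Y` and
`L_Y (Φ x) = L_X x` there. -/
def IsLipIsometric {A B : Type*} [CStarAlgebra A] [PartialOrder A] [StarOrderedRing A]
    [CStarAlgebra B] [PartialOrder B] [StarOrderedRing B]
    (X : LipNormedOperatorSystem A) (Y : LipNormedOperatorSystem B)
    (Φ : X.toSubmodule →ₗ[ℂ] Y.toSubmodule) : Prop :=
  ∀ (x : X.toSubmodule) (hx : (x : A) ∈ X.dom),
    ∃ hy : (Φ x : B) ∈ Y.dom, Y.lip ⟨Φ x, hy⟩ = X.lip ⟨x, hx⟩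

/-- `Φ` and its inverse are Lip-isometric. -/
def IsBiLipIsometric {A B : Type*} [CStarAlgebra A] [PartialOrder A] [StarOrderedRing A]
    [CStarAlgebra B] [PartialOrder B] [StarOrderedRing B]
    (X : LipNormedOperatorSystem A) (Y : LipNormedOperatorSystem B)
    (Φ : X.toSubmodule ≃ₗ[ℂ] Y.toSubmodule) : Prop :=
  IsLipIsometric X Y Φ.toLinearMap ∧ IsLipIsometric Y X Φ.symm.toLinearMap

/-! ### Matrix state spaces and their metrics -/

/-- `UCP_n(X)`: the unital completely positive maps `X → M_n(ℂ)`. -/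
def UCP {A : Type*} [CStarAlgebra A] [PartialOrder A] [StarOrderedRing A]
    (X : OperatorSystem A) (n : ℕ) : Type _ :=
  {φ : X.toSubmodule →ₗ[ℂ] CStarMatrix (Fin n) (Fin n) ℂ // φ X.unit = 1 ∧ IsCP φ}

/-- For a seminorm `L` on a real subspace `D`, the distance
`ρ_{L,n}(φ, ψ) = sup { ‖φ x - ψ x‖ : x ∈ D, L x ≤ 1 }` on `UCP_n(X)`, where `‖·‖` is the
C⋆-norm of `M_n(ℂ)`. -/
@[reducible]
def UCP.lipMetric {A : Type*} [CStarAlgebra A] [PartialOrder A] [StarOrderedRing A]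
    (X : OperatorSystem A) {D : Submodule ℝ A} (L : Seminorm ℝ D) (n : ℕ) :
    PseudoEMetricSpace (UCP X n) where
  edist φ ψ := ⨆ x : {x : X.toSubmodule // ∃ hx : (x : A) ∈ D, L ⟨x, hx⟩ ≤ 1},
    ‖φ.1 x.1 - ψ.1 x.1‖ₑ
  edist_self φ := by simp
  edist_comm φ ψ := by simp only [← edist_eq_enorm_sub, edist_comm]
  edist_triangle φ ψ ω := by
    simp only [← edist_eq_enorm_sub]
    refine iSup_le fun x => (edist_triangle _ (ψ.1 x.1) _).trans ?_
    exact add_le_add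
      (le_iSup (fun x : {x : X.toSubmodule // ∃ hx : (x : A) ∈ D, L ⟨x, hx⟩ ≤ 1} =>
        edist (φ.1 x.1) (ψ.1 x.1)) x)
      (le_iSup (fun x : {x : X.toSubmodule // ∃ hx : (x : A) ∈ D, L ⟨x, hx⟩ ≤ 1} =>
        edist (ψ.1 x.1) (ω.1 x.1)) x)

theorem IsNPositive.comp_fst {A B C : Type*} [CStarAlgebra A] [PartialOrder A] [StarOrderedRing A]
    [CStarAlgebra B] [PartialOrder B] [StarOrderedRing B]
    [CStarAlgebra C] [PartialOrder C] [StarOrderedRing C]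
    (X : OperatorSystem A) (Y : OperatorSystem B) {n : ℕ} {φ : X.toSubmodule →ₗ[ℂ] C}
    (h : IsNPositive n φ) : IsNPositive n (φ ∘ₗ OperatorSystem.fst X Y) := by
  intro M hM
  refine h (M.map fun z => OperatorSystem.fst X Y z) ?_
  exact map_nonneg (CStarMatrix.mapₙₐ (n := Fin n) (NonUnitalStarAlgHom.fst ℂ A B)) hM

theorem IsNPositive.comp_snd {A B C : Type*} [CStarAlgebra A] [PartialOrder A] [StarOrderedRing A]
    [CStarAlgebra B] [PartialOrder B] [StarOrderedRing B]
    [CStarAlgebra C] [PartialOrder C] [StarOrderedRing C]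
    (X : OperatorSystem A) (Y : OperatorSystem B) {n : ℕ} {φ : Y.toSubmodule →ₗ[ℂ] C}
    (h : IsNPositive n φ) : IsNPositive n (φ ∘ₗ OperatorSystem.snd X Y) := by
  intro M hM
  refine h (M.map fun z => OperatorSystem.snd X Y z) ?_
  exact map_nonneg (CStarMatrix.mapₙₐ (n := Fin n) (NonUnitalStarAlgHom.snd ℂ A B)) hM

/-- The embedding `UCP_n(X) → UCP_n(X ⊕ Y)`, composition with the projection. -/
def UCP.inl {A B : Type*} [CStarAlgebra A] [PartialOrder A] [StarOrderedRing A]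
    [CStarAlgebra B] [PartialOrder B] [StarOrderedRing B]
    (X : OperatorSystem A) (Y : OperatorSystem B) (n : ℕ) (φ : UCP X n) : UCP (X.prod Y) n :=
  ⟨φ.1 ∘ₗ OperatorSystem.fst X Y, φ.2.1, fun k => (φ.2.2 k).comp_fst X Y⟩

/-- The embedding `UCP_n(Y) → UCP_n(X ⊕ Y)`, composition with the projection. -/
def UCP.inr {A B : Type*} [CStarAlgebra A] [PartialOrder A] [StarOrderedRing A]
    [CStarAlgebra B] [PartialOrder B] [StarOrderedRing B]
    (X : OperatorSystem A) (Y : OperatorSystem B) (n : ℕ) (ψ : UCP Y n) : UCP (X.prod Y) n :=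
  ⟨ψ.1 ∘ₗ OperatorSystem.snd X Y, ψ.2.1, fun k => (ψ.2.2 k).comp_snd X Y⟩

/-! ### The `n`-distance and the complete distance -/

/-- `L ∈ 𝓜(L_X, L_Y)`: `L` is a closed Lip-norm on `dom L_X ⊕ dom L_Y` which induces `L_X` and
`L_Y` as quotient seminorms. (The completion of `dom L_X ⊕ dom L_Y` is the self-adjoint part of
`X ⊕ Y`, a closed subset of `A × B`.) -/
structure IsAdmissible {A B : Type*} [CStarAlgebra A] [PartialOrder A] [StarOrderedRing A]
    [CStarAlgebra B] [PartialOrder B] [StarOrderedRing B]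
    (X : LipNormedOperatorSystem A) (Y : LipNormedOperatorSystem B)
    (L : Seminorm ℝ (X.dom.prod Y.dom)) : Prop where
  isLipNorm :
    IsLipNorm (⟨(1, 1), ⟨X.one_mem_dom, Y.one_mem_dom⟩⟩ : X.dom.prod Y.dom) L
  isClosed_unitBall : IsClosed {z : A × B | ∃ hz : z ∈ X.dom.prod Y.dom, L ⟨z, hz⟩ ≤ 1}
  induces_left : ∀ x : X.dom,
    IsGLB (Set.range fun y : Y.dom => L ⟨(x, y), ⟨x.2, y.2⟩⟩) (X.lip x)
  induces_right : ∀ y : Y.dom,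
    IsGLB (Set.range fun x : X.dom => L ⟨(x, y), ⟨x.2, y.2⟩⟩) (Y.lip y)

/-- The Hausdorff distance between `UCP_n(X)` and `UCP_n(Y)` in `UCP_n(X ⊕ Y)` for `ρ_{L,n}`. -/
def ucpHausdorff {A B : Type*} [CStarAlgebra A] [PartialOrder A] [StarOrderedRing A]
    [CStarAlgebra B] [PartialOrder B] [StarOrderedRing B]
    (X : LipNormedOperatorSystem A) (Y : LipNormedOperatorSystem B)
    (L : Seminorm ℝ (X.dom.prod Y.dom)) (n : ℕ) : ℝ≥0∞ :=
  letI := UCP.lipMetric (X.toOperatorSystem.prod Y.toOperatorSystem) L n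
  Metric.hausdorffEDist (Set.range (UCP.inl X.toOperatorSystem Y.toOperatorSystem n))
    (Set.range (UCP.inr X.toOperatorSystem Y.toOperatorSystem n))

/-- The `n`-distance. -/
def nDist {A B : Type*} [CStarAlgebra A] [PartialOrder A] [StarOrderedRing A]
    [CStarAlgebra B] [PartialOrder B] [StarOrderedRing B]
    (n : ℕ) (X : LipNormedOperatorSystem A) (Y : LipNormedOperatorSystem B) : ℝ≥0∞ :=
  ⨅ (L : Seminorm ℝ (X.dom.prod Y.dom)) (_ : IsAdmissible X Y L), ucpHausdorff X Y L n

/-- The complete distance; the supremum is over the positive integers. -/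
def completeDist {A B : Type*} [CStarAlgebra A] [PartialOrder A] [StarOrderedRing A]
    [CStarAlgebra B] [PartialOrder B] [StarOrderedRing B]
    (X : LipNormedOperatorSystem A) (Y : LipNormedOperatorSystem B) : ℝ≥0∞ :=
  ⨅ (L : Seminorm ℝ (X.dom.prod Y.dom)) (_ : IsAdmissible X Y L),
    ⨆ (n : ℕ) (_ : 1 ≤ n), ucpHausdorff X Y L n

end

/-!
Two Lip-normed operator systems are compared through their unital completely positive maps into
matrix algebras; the proof rests on the fact that these maps know the matrix order.

*Matrix order and maps into `Mₙ(ℂ)`.* A positive functional `f` on `Mₙ(A)` gives the completely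
positive map `b ↦ (f (Eₖₗ ⊗ b))ₖₗ` (`choiMap`), and an `n`-positive map into `Mₙ(ℂ)` is already
completely positive (`IsNPositive.isCP`), since in both cases the quadratic form of the image of an
`m × m` matrix `M` only involves the `n × n` compressions of `M` by scalar matrices. Adding
to `choiMap f` a small multiple of `b ↦ f (1 ⊗ b) 1` and normalising makes it unital, so by
Hahn–Banach a matrix of size at most `n` over `X` is positive if and only if all elements of
`UCPₙ(X)` send it to a positive matrix (`toCStarMatrix_nonneg_of_forall_ucp`). In particular
`UCPₙ(X)` determines the norm of self-adjoint elements (`norm_le_of_forall_ucp`).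

*From an isomorphism to distance zero.* For a bi-Lip-isometric `Φ` and `γ > 0` the seminorm
`max (L_X x) (L_Y y) (γ⁻¹ ‖Φ x - y‖)` is admissible (`isAdmissible_graphSeminorm`), and every
`φ` in `UCPₙ(X)` is within `γ` of `φ ∘ Φ⁻¹` (`ucpHausdorff_graphSeminorm_le`). That `φ ∘ Φ⁻¹` is
completely positive when `Φ⁻¹` is only `n`-positive is `IsNPositive.isCP`.

*From distance zero to an isomorphism.* Take admissible `Lₖ` whose Hausdorff distances tend to zero.
The pairs `(x, y)` on which nearby pairs `(φ, ψ)` for `Lₖ` agree asymptotically along a free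
ultrafilter form a closed complex subspace of `X × Y` (`asymptoticGraph`). As each `ψ` has a
nearby `φ` and conversely, this subspace transports norms of self-adjoint elements and positivity
of matrices in both directions, so it is the graph of an isomorphism between its projections.
The projections are everything: for `x` in the domain of `L_X`, elements `yₖ` with `Lₖ(x, yₖ)` close
to `L_X x` lie in a ball of `L_Y` that is compact by an Arzelà–Ascoli argument on the state space
(`isCompact_lipBall`), and their limit `y` satisfies `L_Y y ≤ L_X x`
(`exists_dom_mem_asymptoticGraph`).
-/

/-! ### Compression of matrices over a vector space by scalar matrices -/

/-- The compression `aᴴ M a` of an `m × m` matrix `M` over a complex vector space by a scalar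
`m × n` matrix `a`. -/
def compress {m n : ℕ} {E : Type*} [AddCommGroup E] [Module ℂ E]
    (a : Matrix (Fin m) (Fin n) ℂ) (M : Matrix (Fin m) (Fin m) E) : Matrix (Fin n) (Fin n) E :=
  Matrix.of fun k l => ∑ i, ∑ j, (star (a i k) * a j l) • M i j

theorem compress_map {m n : ℕ} {E F : Type*} [AddCommGroup E] [Module ℂ E] [AddCommGroup F]
    [Module ℂ F] (φ : E →ₗ[ℂ] F) (a : Matrix (Fin m) (Fin n) ℂ) (M : Matrix (Fin m) (Fin m) E) :
    (compress a M).map (fun x => φ x) = compress a (M.map fun x => φ x) := by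
  ext k l
  simp [compress, map_sum]

theorem compress_compress {m n p : ℕ} {E : Type*} [AddCommGroup E] [Module ℂ E]
    (a : Matrix (Fin m) (Fin n) ℂ) (b : Matrix (Fin n) (Fin p) ℂ)
    (M : Matrix (Fin m) (Fin m) E) : compress b (compress a M) = compress (a * b) M := by
  ext k l
  simp only [compress, Matrix.of_apply, Finset.smul_sum, Matrix.mul_apply, star_sum,
    Finset.sum_mul_sum, Finset.sum_smul, smul_smul]
  calc _ = ∑ x, ∑ i, ∑ y, ∑ j, (star (b x k) * b y l * (star (a i x) * a j y)) • M i j :=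
        Finset.sum_congr rfl fun _ _ => Finset.sum_comm
    _ = ∑ i, ∑ x, ∑ j, ∑ y, (star (b x k) * b y l * (star (a i x) * a j y)) • M i j := by
        rw [Finset.sum_comm]
        exact Finset.sum_congr rfl fun _ _ => Finset.sum_congr rfl fun _ _ => Finset.sum_comm
    _ = _ := by
        refine Finset.sum_congr rfl fun i _ => ?_
        rw [Finset.sum_comm]
        refine Finset.sum_congr rfl fun j _ => Finset.sum_congr rfl fun x _ =>
          Finset.sum_congr rfl fun y _ => ?_
        rw [star_mul]
        congr 1
        ring

theorem compress_one {m : ℕ} {E : Type*} [AddCommGroup E] [Module ℂ E]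
    (M : Matrix (Fin m) (Fin m) E) : compress 1 M = M := by
  ext k l
  simp [compress, Matrix.one_apply, apply_ite (star : ℂ → ℂ), ite_smul]

theorem nonneg_iff_exists_star_mul_self {A : Type*} [CStarAlgebra A] [PartialOrder A]
    [StarOrderedRing A] {a : A} : 0 ≤ a ↔ ∃ z, a = star z * z :=
  CStarAlgebra.nonneg_iff_eq_star_mul_self

theorem ofMatrix_row_nonneg {A : Type*} [CStarAlgebra A] [PartialOrder A] [StarOrderedRing A]
    {n : ℕ} (u : Fin n → A) :
    0 ≤ (CStarMatrix.ofMatrix (Matrix.of fun k l => star (u k) * u l) :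
      CStarMatrix (Fin n) (Fin n) A) := by
  rcases n with _ | n
  · exact le_of_eq (CStarMatrix.ext fun i => i.elim0)
  · refine nonneg_iff_exists_star_mul_self.mpr
      ⟨CStarMatrix.ofMatrix (Matrix.of fun i l => if i = 0 then u l else 0), ?_⟩
    ext k l
    simp [CStarMatrix.mul_apply, CStarMatrix.star_apply, apply_ite (star : A → A), ite_mul]

theorem compress_nonneg {A : Type*} [CStarAlgebra A] [PartialOrder A] [StarOrderedRing A]
    {m n : ℕ} (a : Matrix (Fin m) (Fin n) ℂ) {M : Matrix (Fin m) (Fin m) A}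
    (hM : 0 ≤ (CStarMatrix.ofMatrix M : CStarMatrix (Fin m) (Fin m) A)) :
    0 ≤ (CStarMatrix.ofMatrix (compress a M) : CStarMatrix (Fin n) (Fin n) A) := by
  obtain ⟨z, hz⟩ := nonneg_iff_exists_star_mul_self.mp hM
  have hzM : ∀ i j, M i j = ∑ r, star (z r i) * z r j := fun i j => by
    have := congrFun (congrFun hz i) j
    simpa [CStarMatrix.mul_apply, CStarMatrix.star_apply] using this
  -- With `M = z⋆ z`, the compression is the sum over `r` of the rank-one matrices given by the
  -- rows of `z a`.
  have key : (CStarMatrix.ofMatrix (compress a M) : CStarMatrix (Fin n) (Fin n) A) =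
      ∑ r, CStarMatrix.ofMatrix (Matrix.of fun k l =>
        star (∑ i, a i k • z r i) * ∑ j, a j l • z r j) := by
    refine CStarMatrix.ext fun k l => ?_
    have hs : (∑ r, CStarMatrix.ofMatrix (Matrix.of fun k l =>
        star (∑ i, a i k • z r i) * ∑ j, a j l • z r j) : CStarMatrix (Fin n) (Fin n) A) k l =
        ∑ r, star (∑ i, a i k • z r i) * ∑ j, a j l • z r j := by
      exact Matrix.sum_apply k l Finset.univ (fun r => Matrix.of fun k l =>
        star (∑ i, a i k • z r i) * ∑ j, a j l • z r j)
    rw [hs]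
    change ∑ i, ∑ j, (star (a i k) * a j l) • M i j = _
    simp only [hzM, star_sum, Finset.sum_mul_sum, Finset.smul_sum, star_smul, smul_mul_smul_comm]
    calc _ = ∑ i, ∑ r, ∑ j, (star (a i k) * a j l) • (star (z r i) * z r j) :=
          Finset.sum_congr rfl fun _ _ => Finset.sum_comm
      _ = _ := Finset.sum_comm
  rw [key]
  exact Finset.sum_nonneg fun r _ => ofMatrix_row_nonneg _

/-! ### Positivity of matrices over `Mₙ(ℂ)` -/

/-- The pairing `∑ₖₗ (Nₖₗ)ₖₗ` of a matrix over `Mₙ(ℂ)` with the vector `∑ₖ eₖ ⊗ eₖ`. -/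
def diagPairing {n : ℕ} (N : Matrix (Fin n) (Fin n) (CStarMatrix (Fin n) (Fin n) ℂ)) : ℂ :=
  ∑ k, ∑ l, N k l k l

theorem diagPairing_compress {m n : ℕ} (h : Matrix (Fin m) (Fin n) ℂ)
    (N : Matrix (Fin m) (Fin m) (CStarMatrix (Fin n) (Fin n) ℂ)) :
    diagPairing (compress h N) = ∑ k, ∑ l, ∑ i, ∑ j, star (h i k) * h j l * N i j k l := by
  refine Finset.sum_congr rfl fun k _ => Finset.sum_congr rfl fun l _ => ?_
  have h1 : (compress h N) k l k l = (∑ i, ∑ j, (star (h i k) * h j l) •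
      ((CStarMatrix.ofMatrix.symm (N i j) : Matrix (Fin n) (Fin n) ℂ))) k l := rfl
  rw [h1]
  simp [Matrix.sum_apply]

theorem star_dotProduct_comp_mulVec {m n : ℕ} (v : Fin m × Fin n → ℂ)
    (N : Matrix (Fin m) (Fin m) (CStarMatrix (Fin n) (Fin n) ℂ)) :
    star v ⬝ᵥ (Matrix.comp (Fin m) (Fin m) (Fin n) (Fin n) ℂ N).mulVec v =
      diagPairing (compress (Matrix.of fun i k => v (i, k)) N) := by
  rw [diagPairing_compress]
  simp only [dotProduct, Matrix.mulVec, Fintype.sum_prod_type, Pi.star_apply,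
    Finset.mul_sum, Matrix.of_apply]
  calc _ = ∑ k, ∑ i, ∑ j, ∑ l, star (v (i, k)) * (N i j k l * v (j, l)) := Finset.sum_comm
    _ = ∑ k, ∑ l, ∑ i, ∑ j, star (v (i, k)) * (N i j k l * v (j, l)) := by
        refine Finset.sum_congr rfl fun k _ => ?_
        calc _ = ∑ j, ∑ i, ∑ l, star (v (i, k)) * (N i j k l * v (j, l)) := Finset.sum_comm
          _ = ∑ j, ∑ l, ∑ i, star (v (i, k)) * (N i j k l * v (j, l)) :=
              Finset.sum_congr rfl fun _ _ => Finset.sum_comm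
          _ = ∑ l, ∑ j, ∑ i, star (v (i, k)) * (N i j k l * v (j, l)) := Finset.sum_comm
          _ = _ := Finset.sum_congr rfl fun _ _ => Finset.sum_comm
    _ = _ := by
        refine Finset.sum_congr rfl fun k _ => Finset.sum_congr rfl fun l _ =>
          Finset.sum_congr rfl fun i _ => Finset.sum_congr rfl fun j _ => ?_
        ring

theorem posSemidef_of_forall_nonneg {ι : Type*} [Fintype ι] [DecidableEq ι] {N : Matrix ι ι ℂ}
    (h : ∀ v : ι → ℂ, 0 ≤ star v ⬝ᵥ N.mulVec v) : N.PosSemidef := by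
  rw [← Matrix.isPositive_toEuclideanLin_iff, LinearMap.isPositive_iff_complex]
  intro x
  have hx := h x.ofLp
  have h2 : inner ℂ (N.toEuclideanLin x) x = star (star x.ofLp ⬝ᵥ N.mulVec x.ofLp) := by
    rw [EuclideanSpace.inner_eq_star_dotProduct, Matrix.star_dotProduct, dotProduct_comm]
    simp
  rw [h2]
  obtain ⟨hre, him⟩ := Complex.nonneg_iff.mp hx
  refine ⟨?_, by simpa using hre⟩
  apply Complex.ext <;> simp [← him]

open scoped MatrixOrder Matrix.Norms.L2Operator in
theorem Matrix.PosSemidef.exists_eq_conjTranspose_mul_self {ι : Type*} [Fintype ι] [DecidableEq ι]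
    {N : Matrix ι ι ℂ} (h : N.PosSemidef) : ∃ B : Matrix ι ι ℂ, N = B.conjTranspose * B :=
  CStarAlgebra.nonneg_iff_eq_star_mul_self.mp h.nonneg

theorem ofMatrix_nonneg_iff_posSemidef_comp {m n : ℕ}
    {N : Matrix (Fin m) (Fin m) (CStarMatrix (Fin n) (Fin n) ℂ)} :
    0 ≤ (CStarMatrix.ofMatrix N : CStarMatrix (Fin m) (Fin m) (CStarMatrix (Fin n) (Fin n) ℂ)) ↔
      (Matrix.comp (Fin m) (Fin m) (Fin n) (Fin n) ℂ N).PosSemidef := by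
  have key : ∀ z : CStarMatrix (Fin m) (Fin m) (CStarMatrix (Fin n) (Fin n) ℂ),
      CStarMatrix.ofMatrix N = star z * z ↔ Matrix.comp (Fin m) (Fin m) (Fin n) (Fin n) ℂ N =
        (Matrix.comp (Fin m) (Fin m) (Fin n) (Fin n) ℂ z).conjTranspose *
          Matrix.comp (Fin m) (Fin m) (Fin n) (Fin n) ℂ z := by
    intro z
    have h1 : ∀ i j k l, (star z * z) i j k l = ((Matrix.comp (Fin m) (Fin m) (Fin n) (Fin n) ℂ
        z).conjTranspose * Matrix.comp (Fin m) (Fin m) (Fin n) (Fin n) ℂ z) (i, k) (j, l) := by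
      intro i j k l
      rw [CStarMatrix.mul_apply, Matrix.mul_apply, Fintype.sum_prod_type]
      refine (Matrix.sum_apply k l Finset.univ (fun r => star (z r i) * z r j)).trans ?_
      rfl
    constructor
    · intro h
      ext ⟨i, k⟩ ⟨j, l⟩
      rw [← h1, ← h]
      rfl
    · intro h
      refine CStarMatrix.ext fun i j => CStarMatrix.ext fun k l => ?_
      rw [h1, ← h]
      rfl
  rw [nonneg_iff_exists_star_mul_self]
  constructor
  · rintro ⟨z, hz⟩
    rw [(key z).mp hz]
    exact Matrix.posSemidef_conjTranspose_mul_self _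
  · intro h
    obtain ⟨B, hB⟩ := h.exists_eq_conjTranspose_mul_self
    refine ⟨(Matrix.comp (Fin m) (Fin m) (Fin n) (Fin n) ℂ).symm B, (key _).mpr ?_⟩
    rw [hB]
    exact congrArg₂ (fun x y : Matrix (Fin m × Fin n) (Fin m × Fin n) ℂ => x.conjTranspose * y)
      ((Equiv.apply_symm_apply _ B).symm) ((Equiv.apply_symm_apply _ B).symm)

/-- A matrix over `Mₙ(ℂ)` is positive as soon as all of its compressions to `n × n` matrices
have a nonnegative pairing with `∑ₖ eₖ ⊗ eₖ`: these numbers are the values of the quadratic form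
of the matrix. -/
theorem ofMatrix_nonneg_iff_diagPairing {m n : ℕ}
    {N : Matrix (Fin m) (Fin m) (CStarMatrix (Fin n) (Fin n) ℂ)} :
    0 ≤ (CStarMatrix.ofMatrix N : CStarMatrix (Fin m) (Fin m) (CStarMatrix (Fin n) (Fin n) ℂ)) ↔
      ∀ h : Matrix (Fin m) (Fin n) ℂ, 0 ≤ diagPairing (compress h N) := by
  rw [ofMatrix_nonneg_iff_posSemidef_comp]
  constructor
  · intro h v
    have := h.dotProduct_mulVec_nonneg (fun p : Fin m × Fin n => v p.1 p.2)
    rwa [star_dotProduct_comp_mulVec] at this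
  · intro h
    refine posSemidef_of_forall_nonneg fun v => ?_
    rw [star_dotProduct_comp_mulVec]
    exact h _

/-! ### Positive functionals detect positivity -/

theorem nonneg_of_forall_real_positive {A : Type*} [CStarAlgebra A] [PartialOrder A]
    [StarOrderedRing A] {y : A}
    (h : ∀ g : A →ₗ[ℝ] ℝ, (∀ a, 0 ≤ a → 0 ≤ g a) → 0 ≤ g y) : 0 ≤ y := by
  by_contra hy
  obtain ⟨g, hg, hgy⟩ := ProperCone.hyperplane_separation_point (ProperCone.positive ℝ A)
    (x₀ := y) (by simpa using hy)
  exact absurd (h g.toLinearMap fun a ha => hg a (by simpa using ha)) (not_le.mpr hgy)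

/-- The complex-linear extension `z ↦ g (ℜ z) + i g (ℑ z)` of the restriction of a real functional
to the self-adjoint part. -/
noncomputable def complexify {A : Type*} [CStarAlgebra A] (g : A →ₗ[ℝ] ℝ) : A →ₗ[ℂ] ℂ where
  toFun z := (g (realPart z : A) : ℂ) + Complex.I * (g (imaginaryPart z : A) : ℂ)
  map_add' x y := by simp; ring
  map_smul' c x := by
    simp only [realPart_smul, imaginaryPart_smul, AddSubgroup.coe_add, AddSubgroup.coe_sub,
      selfAdjoint.val_smul, map_add, map_sub, map_smul, smul_eq_mul, RingHom.id_apply]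
    push_cast
    conv_rhs => rw [← Complex.re_add_im c]
    linear_combination (-(c.im : ℂ) * (g (imaginaryPart x : A) : ℂ)) * Complex.I_mul_I

theorem complexify_nonneg {A : Type*} [CStarAlgebra A] [PartialOrder A] [StarOrderedRing A]
    {g : A →ₗ[ℝ] ℝ} (hg : ∀ a, 0 ≤ a → 0 ≤ g a) {a : A} (ha : 0 ≤ a) : 0 ≤ complexify g a := by
  have hs : IsSelfAdjoint a := .of_nonneg ha
  simpa [complexify, hs.coe_realPart, hs.imaginaryPart] using hg a ha

/-- An element of a C⋆-algebra on which all positive functionals are nonnegative is positive. -/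
theorem nonneg_of_forall_positive {A : Type*} [CStarAlgebra A] [PartialOrder A]
    [StarOrderedRing A] {y : A}
    (h : ∀ f : A →ₗ[ℂ] ℂ, (∀ a, 0 ≤ a → 0 ≤ f a) → 0 ≤ f y) : 0 ≤ y := by
  have key : ∀ g : A →ₗ[ℝ] ℝ, (∀ a, 0 ≤ a → 0 ≤ g a) →
      0 ≤ g (realPart y : A) ∧ g (imaginaryPart y : A) = 0 := by
    intro g hg
    have := Complex.nonneg_iff.mp (h (complexify g) fun a ha => complexify_nonneg hg ha)
    simpa [complexify, eq_comm] using this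
  have him : (imaginaryPart y : A) = 0 := by
    refine le_antisymm ?_ (nonneg_of_forall_real_positive fun g hg => (key g hg).2.ge)
    rw [← neg_nonneg]
    exact nonneg_of_forall_real_positive fun g hg => by simp [(key g hg).2]
  rw [← realPart_add_I_smul_imaginaryPart y, him]
  simpa using nonneg_of_forall_real_positive fun g hg => (key g hg).1

theorem eq_zero_of_positive_of_map_one {A : Type*} [CStarAlgebra A] [PartialOrder A]
    [StarOrderedRing A] {f : A →ₗ[ℂ] ℂ} (hf : ∀ a, 0 ≤ a → 0 ≤ f a) (h1 : f 1 = 0) : f = 0 := by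
  have key : ∀ a : A, IsSelfAdjoint a → f a = 0 := by
    intro a ha
    have e : algebraMap ℝ A ‖a‖ = (‖a‖ : ℂ) • (1 : A) := by
      simp [Algebra.algebraMap_eq_smul_one]
    have h2 := hf _ (sub_nonneg.mpr ha.le_algebraMap_norm_self)
    have h3 := hf _ (sub_nonneg.mpr ha.neg_algebraMap_norm_le_self)
    rw [e] at h2 h3
    rw [map_sub, map_smul, h1, smul_zero, zero_sub] at h2
    rw [sub_neg_eq_add, map_add, map_smul, h1, smul_zero, add_zero] at h3
    exact le_antisymm (neg_nonneg.mp h2) h3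
  ext y
  rw [← realPart_add_I_smul_imaginaryPart y]
  simp [key _ (realPart y).2, key _ (imaginaryPart y).2]

/-! ### Complete positivity of maps into `Mₙ(ℂ)` -/

theorem ofMatrix_const_nonneg_iff {A : Type*} [CStarAlgebra A] [PartialOrder A]
    [StarOrderedRing A] {a : A} :
    0 ≤ (CStarMatrix.ofMatrix (Matrix.of fun _ _ => a) : CStarMatrix (Fin 1) (Fin 1) A) ↔
      0 ≤ a := by
  rw [nonneg_iff_exists_star_mul_self, nonneg_iff_exists_star_mul_self]
  constructor
  · rintro ⟨z, hz⟩
    refine ⟨z 0 0, ?_⟩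
    simpa [CStarMatrix.mul_apply, CStarMatrix.star_apply] using congrFun (congrFun hz 0) 0
  · rintro ⟨z, rfl⟩
    refine ⟨CStarMatrix.ofMatrix (Matrix.of fun _ _ => z), CStarMatrix.ext fun i j => ?_⟩
    simp [CStarMatrix.mul_apply, CStarMatrix.star_apply]

theorem IsNPositive.nonneg {A B : Type*} [CStarAlgebra A] [PartialOrder A] [StarOrderedRing A]
    [CStarAlgebra B] [PartialOrder B] [StarOrderedRing B] {V : Submodule ℂ A}
    {φ : V →ₗ[ℂ] B} (h : IsNPositive 1 φ) {x : V} (hx : 0 ≤ (x : A)) : 0 ≤ φ x :=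
  ofMatrix_const_nonneg_iff.mp (h (Matrix.of fun _ _ => x) (ofMatrix_const_nonneg_iff.mpr hx))

theorem toCStarMatrix_compress {A : Type*} [CStarAlgebra A] {V : Submodule ℂ A} {m n : ℕ}
    (a : Matrix (Fin m) (Fin n) ℂ) (M : Matrix (Fin m) (Fin m) V) :
    toCStarMatrix (compress a M) = CStarMatrix.ofMatrix (compress a (M.map fun x => (x : A))) :=
  congrArg CStarMatrix.ofMatrix (compress_map V.subtype a M)

/-- Maps into `Mₙ(ℂ)` that are `n`-positive are completely positive: the quadratic form of the
image of `M` at `h` only involves the image of the `n × n` matrix `hᴴ M h`. -/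
theorem IsNPositive.isCP {A : Type*} [CStarAlgebra A] [PartialOrder A] [StarOrderedRing A]
    {V : Submodule ℂ A} {n : ℕ} {φ : V →ₗ[ℂ] CStarMatrix (Fin n) (Fin n) ℂ}
    (hφ : IsNPositive n φ) : IsCP φ := by
  intro m M hM
  rw [ofMatrix_nonneg_iff_diagPairing]
  intro h
  rw [← compress_map]
  have h1 := hφ (compress h M) (by rw [toCStarMatrix_compress]; exact compress_nonneg h hM)
  simpa [compress_one] using ofMatrix_nonneg_iff_diagPairing.mp h1 1

/-- The scalar matrix of the inclusion of the first `m` coordinates in `n` coordinates. -/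
def inclusionMatrix (m n : ℕ) : Matrix (Fin m) (Fin n) ℂ :=
  Matrix.of fun i k => if (i : ℕ) = k then 1 else 0

theorem inclusionMatrix_mul_transpose {m n : ℕ} (h : m ≤ n) :
    inclusionMatrix m n * (inclusionMatrix m n).transpose = 1 := by
  ext i j
  rw [Matrix.mul_apply, Finset.sum_eq_single (Fin.castLE h i)]
  · simp [inclusionMatrix, Matrix.one_apply, Fin.ext_iff, eq_comm]
  · intro b _ hb
    have : (i : ℕ) ≠ b := fun hi => hb (Fin.ext hi.symm)
    simp [inclusionMatrix, this]
  · simp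

theorem ofMatrix_conj_nonneg {A : Type*} [CStarAlgebra A] [PartialOrder A] [StarOrderedRing A]
    {m : ℕ} {N : Matrix (Fin m) (Fin m) A}
    (hN : 0 ≤ (CStarMatrix.ofMatrix N : CStarMatrix (Fin m) (Fin m) A)) (w : A) :
    0 ≤ (CStarMatrix.ofMatrix (N.map fun x => star w * x * w) :
      CStarMatrix (Fin m) (Fin m) A) := by
  obtain ⟨z, hz⟩ := nonneg_iff_exists_star_mul_self.mp hN
  refine nonneg_iff_exists_star_mul_self.mpr
    ⟨CStarMatrix.ofMatrix (Matrix.of fun i j => z i j * w), CStarMatrix.ext fun i j => ?_⟩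
  have hzN : N i j = ∑ r, star (z r i) * z r j := by
    simpa [CStarMatrix.mul_apply, CStarMatrix.star_apply] using congrFun (congrFun hz i) j
  simp [CStarMatrix.mul_apply, CStarMatrix.star_apply, hzN, Finset.mul_sum, Finset.sum_mul,
    mul_assoc]

/-! ### The map into `Mₙ(ℂ)` given by a functional on `Mₙ(A)` -/

/-- The map `b ↦ (f (Eₖₗ ⊗ b))ₖₗ` from `A` to `Mₙ(ℂ)` given by a functional `f` on `Mₙ(A)`. -/
noncomputable def choiMap {A : Type*} [CStarAlgebra A] {n : ℕ}
    (f : CStarMatrix (Fin n) (Fin n) A →ₗ[ℂ] ℂ) :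
    A →ₗ[ℂ] CStarMatrix (Fin n) (Fin n) ℂ where
  toFun b := CStarMatrix.ofMatrix
    (Matrix.of fun k l => f (CStarMatrix.ofMatrix (Matrix.single k l b)))
  map_add' x y := by
    refine CStarMatrix.ext fun k l => ?_
    simp [Matrix.single_add, ← CStarMatrix.of_add_of]
  map_smul' c x := by
    refine CStarMatrix.ext fun k l => ?_
    simp [← Matrix.smul_single, ← CStarMatrix.smul_of]

theorem diagPairing_choiMap {A : Type*} [CStarAlgebra A] {n : ℕ}
    (f : CStarMatrix (Fin n) (Fin n) A →ₗ[ℂ] ℂ) (N : Matrix (Fin n) (Fin n) A) :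
    diagPairing (N.map fun x => choiMap f x) = f (CStarMatrix.ofMatrix N) := by
  conv_rhs => rw [Matrix.matrix_eq_sum_single N]
  have : (CStarMatrix.ofMatrix (∑ i, ∑ j, Matrix.single i j (N i j)) :
      CStarMatrix (Fin n) (Fin n) A) = ∑ i, ∑ j, CStarMatrix.ofMatrix (Matrix.single i j (N i j)) :=
    by
      refine (map_sum (CStarMatrix.ofMatrixₗ (m := Fin n) (n := Fin n) (A := A) (R := ℂ))
        (fun i => ∑ j, Matrix.single i j (N i j)) Finset.univ).trans ?_
      exact Finset.sum_congr rfl fun i _ => map_sum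
        (CStarMatrix.ofMatrixₗ (m := Fin n) (n := Fin n) (A := A) (R := ℂ)) _ _
  rw [this]
  simp [diagPairing, choiMap]

theorem choiMap_isCP {A : Type*} [CStarAlgebra A] [PartialOrder A] [StarOrderedRing A] {n : ℕ}
    {f : CStarMatrix (Fin n) (Fin n) A →ₗ[ℂ] ℂ} (hf : ∀ a, 0 ≤ a → 0 ≤ f a)
    (V : Submodule ℂ A) : IsCP (choiMap f ∘ₗ V.subtype) := by
  intro m M hM
  rw [ofMatrix_nonneg_iff_diagPairing]
  intro h
  rw [← compress_map]
  have : (compress h M).map (fun x => (choiMap f ∘ₗ V.subtype) x) =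
      ((compress h M).map fun x => (x : A)).map fun x => choiMap f x := rfl
  rw [this, diagPairing_choiMap]
  refine hf _ ?_
  change 0 ≤ toCStarMatrix (compress h M)
  rw [toCStarMatrix_compress]
  exact compress_nonneg h hM

/-- The functional `N ↦ f (1 ⊗ tr N)` on `Mₙ(A)`. -/
noncomputable def traceFunctional {A : Type*} [CStarAlgebra A] {n : ℕ}
    (f : CStarMatrix (Fin n) (Fin n) A →ₗ[ℂ] ℂ) : CStarMatrix (Fin n) (Fin n) A →ₗ[ℂ] ℂ where
  toFun N := f (CStarMatrix.ofMatrix (Matrix.diagonal fun _ => ∑ k, N k k))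
  map_add' x y := by
    rw [← map_add, CStarMatrix.of_add_of, Matrix.diagonal_add]
    simp [Finset.sum_add_distrib]
  map_smul' c x := by
    rw [RingHom.id_apply, ← map_smul, CStarMatrix.smul_of, ← Matrix.diagonal_smul]
    simp [Finset.smul_sum, Pi.smul_def]

theorem traceFunctional_nonneg {A : Type*} [CStarAlgebra A] [PartialOrder A] [StarOrderedRing A]
    {n : ℕ} {f : CStarMatrix (Fin n) (Fin n) A →ₗ[ℂ] ℂ} (hf : ∀ a, 0 ≤ a → 0 ≤ f a)
    {N : CStarMatrix (Fin n) (Fin n) A} (hN : 0 ≤ N) : 0 ≤ traceFunctional f N := by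
  have h1 : 0 ≤ ∑ k, N k k := by
    obtain ⟨z, rfl⟩ := nonneg_iff_exists_star_mul_self.mp hN
    simp only [CStarMatrix.mul_apply, CStarMatrix.star_apply]
    exact Finset.sum_nonneg fun _ _ => Finset.sum_nonneg fun _ _ => star_mul_self_nonneg _
  obtain ⟨s, hs⟩ := nonneg_iff_exists_star_mul_self.mp h1
  refine hf _ (nonneg_iff_exists_star_mul_self.mpr
    ⟨CStarMatrix.ofMatrix (Matrix.diagonal fun _ => s), ?_⟩)
  rw [hs]
  refine CStarMatrix.ext fun i j => ?_
  simp only [CStarMatrix.mul_apply, CStarMatrix.star_apply, CStarMatrix.ofMatrix_apply,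
    Matrix.diagonal_apply, apply_ite (star : A → A), star_zero]
  simp [eq_comm]

theorem choiMap_traceFunctional_one {A : Type*} [CStarAlgebra A] {n : ℕ}
    (f : CStarMatrix (Fin n) (Fin n) A →ₗ[ℂ] ℂ) :
    choiMap (traceFunctional f) 1 = f 1 • 1 := by
  refine CStarMatrix.ext fun k l => ?_
  change f (CStarMatrix.ofMatrix (Matrix.diagonal fun _ => ∑ i, Matrix.single k l (1 : A) i i)) =
    f 1 • (1 : CStarMatrix (Fin n) (Fin n) ℂ) k l
  rw [CStarMatrix.one_apply]
  by_cases h : k = l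
  · subst h
    have : ∑ i, Matrix.single k k (1 : A) i i = 1 := by
      simp [Matrix.single_apply]
    rw [this]
    simp only [if_true, smul_eq_mul, mul_one]
    exact congrArg f (congrArg CStarMatrix.ofMatrix Matrix.diagonal_one)
  · have : ∑ i, Matrix.single k l (1 : A) i i = 0 := by
      refine Finset.sum_eq_zero fun i _ => ?_
      rw [Matrix.single_apply, if_neg]
      rintro ⟨rfl, rfl⟩
      exact h rfl
    rw [this]
    have h0 : (Matrix.diagonal fun _ => 0 : Matrix (Fin n) (Fin n) A) = 0 := Matrix.diagonal_zero
    simp [h, h0]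

theorem exists_unit_eq_star_mul_self {A : Type*} [CStarAlgebra A] [PartialOrder A]
    [StarOrderedRing A] {a : A} (h0 : 0 ≤ a) (hu : IsUnit a) :
    ∃ z : Aˣ, a = star (z : A) * z := by
  have : IsUnit (CFC.sqrt a) := (CFC.isUnit_sqrt_iff a h0).mpr hu
  obtain ⟨z, hz⟩ := this
  refine ⟨z, ?_⟩
  rw [hz, (IsSelfAdjoint.of_nonneg (CFC.sqrt_nonneg a)).star_eq, CFC.sqrt_mul_sqrt_self a]

theorem isUnit_add_smul_one {A : Type*} [CStarAlgebra A] [PartialOrder A]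
    [StarOrderedRing A] {a : A} (h0 : 0 ≤ a) {c : ℂ} (hc : 0 < c) : IsUnit (a + c • 1) := by
  refine CStarAlgebra.isUnit_of_le (c • (1 : A)) (le_add_of_nonneg_left h0) ?_
  rw [IsStrictlyPositive.iff_of_unital]
  refine ⟨?_, (isUnit_one).smul (Units.mk0 c hc.ne')⟩
  exact smul_nonneg hc.le zero_le_one

/-- A matrix over an operator system which every unital completely positive map into `Mₙ(ℂ)` sends
to a positive matrix is positive. A positive functional `f` on `Mₙ(A)` gives a completely
positive map into `Mₙ(ℂ)`, which is unital up to a conjugation after a small perturbation. -/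
theorem toCStarMatrix_nonneg_of_forall_ucp_self {A : Type*} [CStarAlgebra A] [PartialOrder A]
    [StarOrderedRing A] (X : OperatorSystem A) {n : ℕ}
    (M : Matrix (Fin n) (Fin n) X.toSubmodule)
    (h : ∀ ψ : UCP X n, 0 ≤ (CStarMatrix.ofMatrix (M.map fun x => ψ.1 x) :
      CStarMatrix (Fin n) (Fin n) (CStarMatrix (Fin n) (Fin n) ℂ))) :
    0 ≤ toCStarMatrix M := by
  refine nonneg_of_forall_positive fun f hf => ?_
  by_cases h1 : f 1 = 0
  · simp [eq_zero_of_positive_of_map_one hf h1]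
  have h1' : 0 < f 1 := lt_of_le_of_ne (hf 1 zero_le_one) (Ne.symm h1)
  -- The functional `g = f + δ • traceFunctional f` has `choiMap g 1 ≥ δ f(1) > 0`; writing
  -- `choiMap g 1 = z⋆ z` with `z` invertible, `z⁻¹⋆ (choiMap g) z⁻¹` is unital.
  have key : ∀ δ : ℝ, 0 < δ →
      0 ≤ f (toCStarMatrix M) + δ * traceFunctional f (toCStarMatrix M) := by
    intro δ hδ
    have hδ' : (0 : ℂ) < δ := by exact_mod_cast hδ
    set g := f + (δ : ℂ) • traceFunctional f with hgdef
    have hg : ∀ a, 0 ≤ a → 0 ≤ g a := fun a ha =>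
      add_nonneg (hf a ha) (mul_nonneg hδ'.le (traceFunctional_nonneg hf ha))
    have hcp := choiMap_isCP hg X.toSubmodule
    have hP : choiMap g 1 = choiMap f 1 + (δ * f 1) • 1 := by
      rw [mul_smul, ← choiMap_traceFunctional_one]
      rfl
    have hP0 : 0 ≤ choiMap f 1 :=
      (choiMap_isCP hf X.toSubmodule 1).nonneg (x := X.unit) zero_le_one
    have hu : IsUnit (choiMap g 1) := hP ▸ isUnit_add_smul_one hP0 (mul_pos hδ' h1')
    obtain ⟨z, hz⟩ := exists_unit_eq_star_mul_self
      ((hcp 1).nonneg (x := X.unit) zero_le_one) hu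
    let w : CStarMatrix (Fin n) (Fin n) ℂ := (z⁻¹ : (CStarMatrix (Fin n) (Fin n) ℂ)ˣ)
    have hw : (z : CStarMatrix (Fin n) (Fin n) ℂ) * w = 1 := z.mul_inv
    have hw' : w * z = 1 := z.inv_mul
    have hsw : star w * star (z : CStarMatrix (Fin n) (Fin n) ℂ) = 1 := by
      rw [← star_mul, hw, star_one]
    have hsw' : star (z : CStarMatrix (Fin n) (Fin n) ℂ) * star w = 1 := by
      rw [← star_mul, hw', star_one]
    let ψ : UCP X n := ⟨LinearMap.mulRight ℂ w ∘ₗ LinearMap.mulLeft ℂ (star w) ∘ₗ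
      choiMap g ∘ₗ X.toSubmodule.subtype, by
        change star w * choiMap g 1 * w = 1
        rw [show choiMap g 1 = star (z : CStarMatrix (Fin n) (Fin n) ℂ) * z from hz,
          ← mul_assoc, hsw, one_mul, hw],
      fun m N hN => ofMatrix_conj_nonneg (hcp m N hN) w⟩
    have h2 := ofMatrix_conj_nonneg (h ψ) z
    have h3 : (M.map fun x => ψ.1 x).map (fun x => star (z : CStarMatrix (Fin n) (Fin n) ℂ) * x * z)
        = (M.map fun x => (x : A)).map fun x => choiMap g x := by
      ext1 i j
      change star (z : CStarMatrix (Fin n) (Fin n) ℂ) * (star w * choiMap g (M i j) * w) * z = _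
      rw [mul_assoc, mul_assoc _ w, hw', mul_one, ← mul_assoc, hsw', one_mul]
      rfl
    rw [h3] at h2
    have h4 := ofMatrix_nonneg_iff_diagPairing.mp h2 1
    rw [compress_one, diagPairing_choiMap] at h4
    exact h4
  have hlim : Filter.Tendsto (fun δ : ℝ => f (toCStarMatrix M) +
      (δ : ℂ) * traceFunctional f (toCStarMatrix M)) (nhdsWithin 0 (Set.Ioi 0))
      (nhds (f (toCStarMatrix M))) := by
    have : Continuous fun δ : ℝ => f (toCStarMatrix M) +
      (δ : ℂ) * traceFunctional f (toCStarMatrix M) := by fun_prop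
    simpa using (this.tendsto 0).mono_left nhdsWithin_le_nhds
  exact ge_of_tendsto hlim (Filter.eventually_of_mem self_mem_nhdsWithin key)

theorem toCStarMatrix_nonneg_of_forall_ucp {A : Type*} [CStarAlgebra A] [PartialOrder A]
    [StarOrderedRing A] (X : OperatorSystem A) {m n : ℕ} (hmn : m ≤ n)
    (M : Matrix (Fin m) (Fin m) X.toSubmodule)
    (h : ∀ ψ : UCP X n, 0 ≤ (CStarMatrix.ofMatrix (M.map fun x => ψ.1 x) :
      CStarMatrix (Fin m) (Fin m) (CStarMatrix (Fin n) (Fin n) ℂ))) :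
    0 ≤ toCStarMatrix M := by
  have h1 := toCStarMatrix_nonneg_of_forall_ucp_self X (compress (inclusionMatrix m n) M)
    fun ψ => by
      rw [compress_map]
      exact compress_nonneg _ (h ψ)
  rw [toCStarMatrix_compress] at h1
  have h2 := compress_nonneg (inclusionMatrix m n).transpose h1
  rwa [compress_compress, inclusionMatrix_mul_transpose hmn, compress_one] at h2

/-! ### Norm estimates for unital positive maps -/

theorem IsSelfAdjoint.norm_le_iff {A : Type*} [CStarAlgebra A] [PartialOrder A]
    [StarOrderedRing A] {a : A} (ha : IsSelfAdjoint a) {c : ℝ} (hc : 0 ≤ c) :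
    ‖a‖ ≤ c ↔ -(algebraMap ℝ A c) ≤ a ∧ a ≤ algebraMap ℝ A c := by
  constructor
  · intro h
    have hmono : algebraMap ℝ A ‖a‖ ≤ algebraMap ℝ A c := algebraMap_mono _ h
    exact ⟨(neg_le_neg hmono).trans ha.neg_algebraMap_norm_le_self,
      ha.le_algebraMap_norm_self.trans hmono⟩
  · rintro ⟨h1, h2⟩
    rcases subsingleton_or_nontrivial A with hA | hA
    · rwa [Subsingleton.elim a 0, norm_zero]
    rcases CStarAlgebra.norm_or_neg_norm_mem_spectrum ha with h | h
    · exact (le_algebraMap_iff_spectrum_le (a := a)).mp h2 _ h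
    · rw [← map_neg] at h1
      have := (algebraMap_le_iff_le_spectrum (a := a)).mp h1 _ h
      linarith

theorem algebraMap_real_eq_complex_smul_one {A : Type*} [CStarAlgebra A] (c : ℝ) :
    algebraMap ℝ A c = (c : ℂ) • (1 : A) := by
  simp [Algebra.algebraMap_eq_smul_one]

theorem map_smul_unit {A B : Type*} [CStarAlgebra A] [CStarAlgebra B] {X : OperatorSystem A}
    {φ : X.toSubmodule →ₗ[ℂ] B} (h1 : φ X.unit = 1) (c : ℝ) :
    φ ((c : ℂ) • X.unit) = algebraMap ℝ B c := by
  rw [map_smul, h1, algebraMap_real_eq_complex_smul_one]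

/-- The decomposition of an element of an operator system into self-adjoint elements of it. -/
theorem OperatorSystem.exists_add_I_smul {A : Type*} [CStarAlgebra A] (X : OperatorSystem A)
    (x : X.toSubmodule) :
    ∃ a b : X.toSubmodule, IsSelfAdjoint (a : A) ∧ IsSelfAdjoint (b : A) ∧
      (a : A) = realPart (x : A) ∧ (b : A) = imaginaryPart (x : A) ∧ x = a + Complex.I • b := by
  have ha : (realPart (x : A) : A) ∈ X.toSubmodule := by
    rw [realPart_apply_coe]
    have := X.toSubmodule.smul_mem ((2 : ℂ)⁻¹) (X.toSubmodule.add_mem x.2 (X.star_mem' x.2))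
    convert this using 1
    rw [← Complex.coe_smul]
    simp
  have hb : (imaginaryPart (x : A) : A) ∈ X.toSubmodule := by
    have h := realPart_add_I_smul_imaginaryPart (x : A)
    have h2 : (imaginaryPart (x : A) : A) = (-Complex.I) • ((x : A) - (realPart (x : A) : A)) := by
      nth_rw 2 [← h]
      simp [smul_smul]
    rw [h2]
    exact X.toSubmodule.smul_mem _ (X.toSubmodule.sub_mem x.2 ha)
  exact ⟨⟨_, ha⟩, ⟨_, hb⟩, (realPart (x : A)).2, (imaginaryPart (x : A)).2, rfl, rfl,
    Subtype.ext (realPart_add_I_smul_imaginaryPart (x : A)).symm⟩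

section PositiveMap

variable {A B : Type*} [CStarAlgebra A] [PartialOrder A] [StarOrderedRing A]
  [CStarAlgebra B] [PartialOrder B] [StarOrderedRing B] {X : OperatorSystem A}
  {φ : X.toSubmodule →ₗ[ℂ] B}

theorem isSelfAdjoint_map_of_positive (h1 : φ X.unit = 1) (hφ : IsNPositive 1 φ) {x : X.toSubmodule}
    (hx : IsSelfAdjoint (x : A)) : IsSelfAdjoint (φ x) := by
  have h2 : 0 ≤ φ (((‖(x : A)‖ : ℝ) : ℂ) • X.unit - x) := hφ.nonneg (by
    have := hx.le_algebraMap_norm_self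
    rw [algebraMap_real_eq_complex_smul_one] at this
    exact sub_nonneg.mpr this)
  rw [map_sub, map_smul_unit h1] at h2
  have h3 := IsSelfAdjoint.of_nonneg h2
  have h4 : IsSelfAdjoint (algebraMap ℝ B ‖(x : A)‖) := IsSelfAdjoint.algebraMap B (.all _)
  simpa using h4.sub h3

/-- A unital positive map is contractive on self-adjoint elements. -/
theorem norm_map_le (h1 : φ X.unit = 1) (hφ : IsNPositive 1 φ) {x : X.toSubmodule}
    (hx : IsSelfAdjoint (x : A)) : ‖φ x‖ ≤ ‖(x : A)‖ := by
  refine ((isSelfAdjoint_map_of_positive h1 hφ hx).norm_le_iff (norm_nonneg _)).mpr ⟨?_, ?_⟩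
  · have h2 : 0 ≤ φ (x + ((‖(x : A)‖ : ℝ) : ℂ) • X.unit) := hφ.nonneg (by
      have := hx.neg_algebraMap_norm_le_self
      rw [algebraMap_real_eq_complex_smul_one] at this
      exact neg_le_iff_add_nonneg.mp this)
    rw [map_add, map_smul_unit h1] at h2
    exact neg_le_iff_add_nonneg.mpr h2
  · have h2 : 0 ≤ φ (((‖(x : A)‖ : ℝ) : ℂ) • X.unit - x) := hφ.nonneg (by
      have := hx.le_algebraMap_norm_self
      rw [algebraMap_real_eq_complex_smul_one] at this
      exact sub_nonneg.mpr this)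
    rw [map_sub, map_smul_unit h1] at h2
    exact sub_nonneg.mp h2

theorem map_star_of_positive (h1 : φ X.unit = 1) (hφ : IsNPositive 1 φ) (x : X.toSubmodule) :
    φ ⟨star (x : A), X.star_mem' x.2⟩ = star (φ x) := by
  obtain ⟨a, b, ha, hb, -, -, hx⟩ := X.exists_add_I_smul x
  have h2 : (⟨star (x : A), X.star_mem' x.2⟩ : X.toSubmodule) = a - Complex.I • b := by
    apply Subtype.ext
    simp [hx, ha.star_eq, hb.star_eq, sub_eq_add_neg]
  have ha' := (isSelfAdjoint_map_of_positive h1 hφ ha).star_eq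
  have hb' := (isSelfAdjoint_map_of_positive h1 hφ hb).star_eq
  rw [h2, hx]
  simp [ha', hb', sub_eq_add_neg]

theorem map_nonneg_of_norm_map_le (h1 : φ X.unit = 1) (hφ : IsNPositive 1 φ)
    {x : X.toSubmodule} (hx : IsSelfAdjoint (x : A)) {c : ℝ} (hc : 0 ≤ c) (h : ‖φ x‖ ≤ c) :
    0 ≤ φ (x + (c : ℂ) • X.unit) ∧ 0 ≤ φ ((c : ℂ) • X.unit - x) := by
  obtain ⟨h2, h3⟩ := ((isSelfAdjoint_map_of_positive h1 hφ hx).norm_le_iff hc).mp h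
  rw [map_add, map_sub, map_smul_unit h1]
  exact ⟨neg_le_iff_add_nonneg.mp h2, sub_nonneg.mpr h3⟩

end PositiveMap

theorem norm_map_le_two_mul {A B : Type*} [CStarAlgebra A] [PartialOrder A] [StarOrderedRing A]
    [CStarAlgebra B] [PartialOrder B] [StarOrderedRing B] {X : OperatorSystem A}
    {φ : X.toSubmodule →ₗ[ℂ] B} (h1 : φ X.unit = 1) (hφ : IsNPositive 1 φ) (x : X.toSubmodule) :
    ‖φ x‖ ≤ 2 * ‖(x : A)‖ := by
  obtain ⟨a, b, ha, hb, hax, hbx, hx⟩ := X.exists_add_I_smul x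
  have e1 := norm_map_le h1 hφ ha
  have e2 := norm_map_le h1 hφ hb
  rw [hax] at e1
  rw [hbx] at e2
  have e3 : ‖(realPart (x : A) : A)‖ ≤ ‖(x : A)‖ := realPart.norm_le (x : A)
  have e4 : ‖(imaginaryPart (x : A) : A)‖ ≤ ‖(x : A)‖ := imaginaryPart.norm_le (x : A)
  nth_rw 1 [hx]
  rw [map_add, map_smul]
  refine (norm_add_le _ _).trans ?_
  rw [norm_smul, Complex.norm_I, one_mul, two_mul]
  exact add_le_add (e1.trans e3) (e2.trans e4)

theorem continuous_of_unital_positive {A B : Type*} [CStarAlgebra A] [PartialOrder A]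
    [StarOrderedRing A] [CStarAlgebra B] [PartialOrder B] [StarOrderedRing B]
    {X : OperatorSystem A} {φ : X.toSubmodule →ₗ[ℂ] B} (h1 : φ X.unit = 1)
    (hφ : IsNPositive 1 φ) : Continuous φ :=
  AddMonoidHomClass.continuous_of_bound φ 2 (norm_map_le_two_mul h1 hφ)

/-- The unital completely positive maps into `Mₙ(ℂ)` with `n ≥ 1` determine the norm of a
self-adjoint element. -/
theorem norm_le_of_forall_ucp {A : Type*} [CStarAlgebra A] [PartialOrder A]
    [StarOrderedRing A] (X : OperatorSystem A) {n : ℕ} (hn : 1 ≤ n) {x : X.toSubmodule}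
    (hx : IsSelfAdjoint (x : A)) {c : ℝ} (hc : 0 ≤ c) (h : ∀ ψ : UCP X n, ‖ψ.1 x‖ ≤ c) :
    ‖(x : A)‖ ≤ c := by
  have key : ∀ y : X.toSubmodule, (∀ ψ : UCP X n, 0 ≤ ψ.1 y) → 0 ≤ (y : A) := by
    intro y hy
    have h1 := toCStarMatrix_nonneg_of_forall_ucp X hn (Matrix.of fun _ _ => y) fun ψ => by
      have h2 := ofMatrix_const_nonneg_iff.mpr (hy ψ)
      exact h2
    exact ofMatrix_const_nonneg_iff.mp h1
  have hle := fun ψ : UCP X n => map_nonneg_of_norm_map_le ψ.2.1 (ψ.2.2 1) hx hc (h ψ)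
  refine (hx.norm_le_iff hc).mpr ?_
  rw [algebraMap_real_eq_complex_smul_one]
  exact ⟨neg_le_iff_add_nonneg.mpr (key (x + (c : ℂ) • X.unit) fun ψ => (hle ψ).1),
    sub_nonneg.mp (key ((c : ℂ) • X.unit - x) fun ψ => (hle ψ).2)⟩

/-! ### States of an order-unit space of self-adjoint elements -/

section OrderState

variable {A : Type*} [CStarAlgebra A] [PartialOrder A] [StarOrderedRing A] {D : Submodule ℝ A}
  {h1 : (1 : A) ∈ D}

theorem OrderState.abs_le_norm (hsa : ∀ x ∈ D, IsSelfAdjoint x)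
    (μ : OrderState D ⟨1, h1⟩) (a : D) : |μ.1 a| ≤ ‖(a : A)‖ := by
  have hu : μ.1 (‖(a : A)‖ • ⟨1, h1⟩) = ‖(a : A)‖ := by rw [map_smul, μ.2.2, smul_eq_mul, mul_one]
  rw [abs_le]
  constructor
  · have h2 := μ.2.1 (a + ‖(a : A)‖ • ⟨1, h1⟩) (by
      have := (hsa a a.2).neg_algebraMap_norm_le_self
      rw [Algebra.algebraMap_eq_smul_one] at this
      exact neg_le_iff_add_nonneg.mp this)
    rw [map_add, hu] at h2
    linarith
  · have h2 := μ.2.1 (‖(a : A)‖ • ⟨1, h1⟩ - a) (by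
      have := (hsa a a.2).le_algebraMap_norm_self
      rw [Algebra.algebraMap_eq_smul_one] at this
      exact sub_nonneg.mpr this)
    rw [map_sub, hu] at h2
    linarith

theorem OrderState.nonneg_of_forall (hsa : ∀ x ∈ D, IsSelfAdjoint x) {a : D}
    (h : ∀ μ : OrderState D ⟨1, h1⟩, 0 ≤ μ.1 a) : 0 ≤ (a : A) := by
  refine nonneg_of_forall_real_positive fun g hg => ?_
  rcases (hg 1 zero_le_one).eq_or_lt with h0 | h0
  · have h2 := hg _ (neg_le_iff_add_nonneg.mp (hsa a a.2).neg_algebraMap_norm_le_self)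
    rw [Algebra.algebraMap_eq_smul_one, map_add, map_smul, ← h0] at h2
    simpa using h2
  · have h2 := h ⟨(g 1)⁻¹ • (g ∘ₗ D.subtype), fun b hb =>
      mul_nonneg (inv_nonneg.mpr h0.le) (hg _ hb), by simp [h0.ne']⟩
    exact nonneg_of_mul_nonneg_right h2 (inv_pos.mpr h0)

theorem OrderState.norm_le_of_forall (hsa : ∀ x ∈ D, IsSelfAdjoint x) {a : D} {c : ℝ}
    (hc : 0 ≤ c) (h : ∀ μ : OrderState D ⟨1, h1⟩, |μ.1 a| ≤ c) : ‖(a : A)‖ ≤ c := by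
  have hu : ∀ μ : OrderState D ⟨1, h1⟩, μ.1 (c • ⟨1, h1⟩) = c := fun μ => by
    rw [map_smul, μ.2.2, smul_eq_mul, mul_one]
  refine ((hsa a a.2).norm_le_iff hc).mpr ⟨?_, ?_⟩
  · rw [Algebra.algebraMap_eq_smul_one]
    refine neg_le_iff_add_nonneg.mpr (OrderState.nonneg_of_forall (h1 := h1)
      (a := a + c • ⟨1, h1⟩) hsa fun μ => ?_)
    rw [map_add, hu]
    linarith [(abs_le.mp (h μ)).1]
  · rw [Algebra.algebraMap_eq_smul_one]
    refine sub_nonneg.mp (OrderState.nonneg_of_forall (h1 := h1) (a := c • ⟨1, h1⟩ - a) hsa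
      fun μ => ?_)
    rw [map_sub, hu]
    linarith [(abs_le.mp (h μ)).2]

theorem OrderState.compactSpace_weakStar (hsa : ∀ x ∈ D, IsSelfAdjoint x) :
    @CompactSpace (OrderState D ⟨1, h1⟩) (OrderState.weakStar D ⟨1, h1⟩) := by
  let _ := OrderState.weakStar D (⟨1, h1⟩ : D)
  have hind : Topology.IsInducing (fun (μ : OrderState D ⟨1, h1⟩) (a : D) => μ.1 a) := ⟨rfl⟩
  refine ⟨hind.isCompact_iff.mpr ?_⟩
  have himg : (fun (μ : OrderState D ⟨1, h1⟩) (a : D) => μ.1 a) '' Set.univ =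
      {F : D → ℝ | (∀ a b, F (a + b) = F a + F b) ∧ (∀ (c : ℝ) a, F (c • a) = c * F a) ∧
        (∀ a, 0 ≤ a → 0 ≤ F a) ∧ F ⟨1, h1⟩ = 1} := by
    ext F
    constructor
    · rintro ⟨μ, -, rfl⟩
      exact ⟨map_add μ.1, fun c a => by simp, μ.2.1, μ.2.2⟩
    · rintro ⟨ha, hs, hp, hu⟩
      exact ⟨⟨{ toFun := F, map_add' := ha, map_smul' := hs }, hp, hu⟩, trivial, rfl⟩
  refine (isCompact_univ_pi fun a : D => isCompact_Icc (a := -‖(a : A)‖)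
    (b := ‖(a : A)‖)).of_isClosed_subset ?_ ?_
  · rw [himg]
    simp only [Set.ofPred_and, Set.ofPred_forall]
    refine .inter ?_ (.inter ?_ (.inter ?_ ?_))
    · exact isClosed_iInter fun a => isClosed_iInter fun b =>
        isClosed_eq (by fun_prop) (by fun_prop)
    · exact isClosed_iInter fun a => isClosed_iInter fun b =>
        isClosed_eq (by fun_prop) (by fun_prop)
    · exact isClosed_iInter fun a => isClosed_iInter fun _ =>
        isClosed_le (by fun_prop) (by fun_prop)
    · exact isClosed_eq (by fun_prop) (by fun_prop)
  · rintro _ ⟨μ, -, rfl⟩ a -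
    exact abs_le.mp (OrderState.abs_le_norm hsa μ a)

end OrderState

/-! ### Balls of a Lip-norm are compact -/

theorem OrderState.abs_sub_le_of_lipMetric {V : Type*} [AddCommGroup V] [Module ℝ V]
    [PartialOrder V] {e : V} {L : Seminorm ℝ V} {μ ν : OrderState V e} {δ C : ℝ} (hδ : 0 ≤ δ)
    (hC : 0 < C) (h : (OrderState.lipMetric e L).edist μ ν ≤ ENNReal.ofReal δ) {a : V}
    (ha : L a ≤ C) : |μ.1 a - ν.1 a| ≤ C * δ := by
  have h1 : L (C⁻¹ • a) ≤ 1 := by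
    rw [map_smul_eq_mul, Real.norm_of_nonneg (inv_nonneg.mpr hC.le), inv_mul_le_iff₀ hC]
    simpa using ha
  have h2 := (le_iSup₂ (f := fun (a : V) (_ : L a ≤ 1) => ENNReal.ofReal |μ.1 a - ν.1 a|) _
    h1).trans h
  rw [ENNReal.ofReal_le_ofReal_iff hδ, map_smul, map_smul, ← smul_sub, abs_smul,
    abs_of_nonneg (inv_nonneg.mpr hC.le), smul_eq_mul, inv_mul_le_iff₀ hC] at h2
  exact h2

section Compact

variable {A : Type*} [CStarAlgebra A] [PartialOrder A] [StarOrderedRing A] {D : Submodule ℝ A}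
  {h1 : (1 : A) ∈ D}

/-- An ultrafilter on a norm-bounded ball of a Lip-norm is Cauchy: it converges at each of
finitely many states that are `δ`-dense in the state space, hence uniformly on all states. -/
theorem totallyBounded_lipBall (hsa : ∀ x ∈ D, IsSelfAdjoint x) {L : Seminorm ℝ D}
    (hL : IsLipNorm (⟨1, h1⟩ : D) L) {C : ℝ} (hC : 0 < C) (R : ℝ) :
    TotallyBounded {x : A | (∃ hx : x ∈ D, L ⟨x, hx⟩ ≤ C) ∧ ‖x‖ ≤ R} := by
  classical
  rw [totallyBounded_iff_ultrafilter]
  intro f hf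
  rw [Filter.le_principal_iff] at hf
  rw [Metric.cauchy_iff]
  refine ⟨inferInstance, fun ε hε => ?_⟩
  -- The distance of two elements of the ball with close values at the `δ`-net is at most
  -- `(2 C + 2) δ`.
  set δ : ℝ := ε / (2 * C + 3) with hδdef
  have hδ : 0 < δ := by positivity
  obtain ⟨F, hF, hcov⟩ : ∃ F : Set (OrderState D ⟨1, h1⟩), F.Finite ∧
      ∀ μ, ∃ ν ∈ F, (OrderState.lipMetric (⟨1, h1⟩ : D) L).edist μ ν < ENNReal.ofReal δ := by
    have hc := OrderState.compactSpace_weakStar (h1 := h1) hsa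
    rw [← hL.induces_weakStar] at hc
    let _ := OrderState.lipMetric (⟨1, h1⟩ : D) L
    obtain ⟨F, hF, h⟩ := EMetric.totallyBounded_iff.mp (isCompact_univ (X :=
      OrderState D ⟨1, h1⟩)).totallyBounded (ENNReal.ofReal δ) (by simpa using hδ)
    refine ⟨F, hF, fun μ => ?_⟩
    simpa using h (Set.mem_univ μ)
  let ev : OrderState D ⟨1, h1⟩ → A → ℝ := fun ν x => if hx : x ∈ D then ν.1 ⟨x, hx⟩ else 0
  have hlim : ∀ ν : OrderState D ⟨1, h1⟩, ∃ g : ℝ, {x | |ev ν x - g| < δ} ∈ f := by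
    intro ν
    have hb : Set.Icc (-R) R ∈ f.map (ev ν) := by
      rw [Ultrafilter.mem_map]
      refine Filter.mem_of_superset hf ?_
      rintro x ⟨⟨hx, -⟩, hxR⟩
      simp only [Set.mem_preimage, ev, dif_pos hx]
      exact abs_le.mp ((OrderState.abs_le_norm hsa ν ⟨x, hx⟩).trans hxR)
    obtain ⟨g, -, hg⟩ := isCompact_Icc.ultrafilter_le_nhds (f.map (ev ν)) (by simpa using hb)
    refine ⟨g, ?_⟩
    have := hg (Metric.ball_mem_nhds g hδ)
    simpa [Metric.ball, Real.dist_eq] using this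
  choose g hg using hlim
  refine ⟨{x : A | (∃ hx : x ∈ D, L ⟨x, hx⟩ ≤ C) ∧ ‖x‖ ≤ R} ∩ ⋂ ν ∈ F, {x | |ev ν x - g ν| < δ},
    Filter.inter_mem hf ((Filter.biInter_mem hF).mpr fun ν _ => hg ν), ?_⟩
  rintro x ⟨⟨⟨hx, hxL⟩, -⟩, hxF⟩ y ⟨⟨⟨hy, hyL⟩, -⟩, hyF⟩
  simp only [Set.mem_iInter, Set.mem_ofPred_eq] at hxF hyF
  rw [dist_eq_norm]
  have hle : ‖((⟨x, hx⟩ - ⟨y, hy⟩ : D) : A)‖ ≤ (2 * C + 2) * δ := by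
    refine OrderState.norm_le_of_forall (h1 := h1) hsa (by positivity) fun μ => ?_
    obtain ⟨ν, hν, hμν⟩ := hcov μ
    have e1 := OrderState.abs_sub_le_of_lipMetric hδ.le hC hμν.le hxL
    have e2 := OrderState.abs_sub_le_of_lipMetric hδ.le hC hμν.le hyL
    have e3 := hxF ν hν
    have e4 := hyF ν hν
    simp only [ev, dif_pos hx, dif_pos hy] at e3 e4
    rw [map_sub]
    rw [abs_le] at e1 e2 ⊢
    rw [abs_lt] at e3 e4
    constructor <;> linarith [e1.1, e1.2, e2.1, e2.2, e3.1, e3.2, e4.1, e4.2]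
  refine lt_of_le_of_lt hle ?_
  calc (2 * C + 2) * δ < (2 * C + 3) * δ := by gcongr; linarith
    _ = ε := by rw [hδdef]; field_simp

theorem isClosed_lipBall {A : Type*} [CStarAlgebra A] {D : Submodule ℝ A} {L : Seminorm ℝ D}
    (hcl : IsClosed {x : A | ∃ hx : x ∈ D, L ⟨x, hx⟩ ≤ 1}) {C : ℝ} (hC : 0 < C) :
    IsClosed {x : A | ∃ hx : x ∈ D, L ⟨x, hx⟩ ≤ C} := by
  have : {x : A | ∃ hx : x ∈ D, L ⟨x, hx⟩ ≤ C} =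
      (fun x => C⁻¹ • x) ⁻¹' {x : A | ∃ hx : x ∈ D, L ⟨x, hx⟩ ≤ 1} := by
    ext x
    have hL : ∀ hx : x ∈ D, L ⟨C⁻¹ • x, D.smul_mem _ hx⟩ = C⁻¹ * L ⟨x, hx⟩ := fun hx => by
      have := map_smul_eq_mul L C⁻¹ ⟨x, hx⟩
      rwa [Real.norm_of_nonneg (inv_nonneg.mpr hC.le)] at this
    constructor
    · rintro ⟨hx, h⟩
      refine ⟨D.smul_mem _ hx, ?_⟩
      rw [hL hx, inv_mul_le_iff₀ hC]
      simpa using h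
    · rintro ⟨hx, h⟩
      have hx' : x ∈ D := by simpa [smul_smul, hC.ne'] using D.smul_mem C hx
      refine ⟨hx', ?_⟩
      rw [hL hx', inv_mul_le_iff₀ hC] at h
      simpa using h
  rw [this]
  exact hcl.preimage (continuous_const_smul _)

theorem isCompact_lipBall (hsa : ∀ x ∈ D, IsSelfAdjoint x) {L : Seminorm ℝ D}
    (hL : IsLipNorm (⟨1, h1⟩ : D) L) (hcl : IsClosed {x : A | ∃ hx : x ∈ D, L ⟨x, hx⟩ ≤ 1})
    {C : ℝ} (hC : 0 < C) (R : ℝ) :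
    IsCompact {x : A | (∃ hx : x ∈ D, L ⟨x, hx⟩ ≤ C) ∧ ‖x‖ ≤ R} :=
  isCompact_iff_totallyBounded_isComplete.mpr ⟨totallyBounded_lipBall hsa hL hC R,
    ((isClosed_lipBall hcl hC).inter (isClosed_le continuous_norm continuous_const)).isComplete⟩

end Compact

/-! ### The topology of a Lip-norm -/

section LipTopology

variable {V : Type*} [AddCommGroup V] [Module ℝ V] [PartialOrder V] {e : V} {L : Seminorm ℝ V}

theorem OrderState.lipMetric_le_weakStar (h : ∀ a, L a = 0 → ∃ r : ℝ, a = r • e) :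
    (OrderState.lipMetric e L).toUniformSpace.toTopologicalSpace ≤ OrderState.weakStar V e := by
  let _ := OrderState.lipMetric e L
  rw [OrderState.weakStar, ← continuous_iff_le_induced, continuous_pi_iff]
  intro a
  by_cases ha : L a = 0
  · obtain ⟨r, rfl⟩ := h a ha
    have : (fun μ : OrderState V e => μ.1 (r • e)) = fun _ => r := by
      funext μ
      rw [map_smul, μ.2.2, smul_eq_mul, mul_one]
    rw [this]
    exact continuous_const
  · have hpos : 0 < L a := lt_of_le_of_ne (apply_nonneg L a) (Ne.symm ha)
    have hlip : LipschitzWith (L a).toNNReal fun μ : OrderState V e => μ.1 a := by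
      intro μ ν
      have h1 : L ((L a)⁻¹ • a) ≤ 1 := by
        rw [map_smul_eq_mul, Real.norm_of_nonneg (inv_nonneg.mpr hpos.le), inv_mul_cancel₀ ha]
      have h2 := le_iSup₂ (f := fun (a : V) (_ : L a ≤ 1) => ENNReal.ofReal |μ.1 a - ν.1 a|) _ h1
      have h3 : |μ.1 a - ν.1 a| = L a * |μ.1 ((L a)⁻¹ • a) - ν.1 ((L a)⁻¹ • a)| := by
        rw [map_smul, map_smul, ← smul_sub, abs_smul, abs_of_nonneg (inv_nonneg.mpr hpos.le),
          smul_eq_mul, mul_inv_cancel_left₀ ha]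
      rw [edist_dist, Real.dist_eq, h3, ENNReal.ofReal_mul hpos.le]
      exact mul_le_mul_right h2 _
    exact hlip.continuous

theorem IsLipNorm.tendsto_edist (hL : IsLipNorm e L) (μ : OrderState V e) :
    Filter.Tendsto (fun ν => (OrderState.lipMetric e L).edist ν μ)
      (@nhds _ (OrderState.weakStar V e) μ) (nhds 0) := by
  rw [← hL.induces_weakStar]
  let _ := OrderState.lipMetric e L
  exact tendsto_iff_edist_tendsto_0.mp Filter.tendsto_id

theorem OrderState.weakStar_le_lipMetric
    (h : ∀ μ : OrderState V e, Filter.Tendsto (fun ν => (OrderState.lipMetric e L).edist ν μ)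
      (@nhds _ (OrderState.weakStar V e) μ) (nhds 0)) :
    OrderState.weakStar V e ≤ (OrderState.lipMetric e L).toUniformSpace.toTopologicalSpace := by
  rw [le_iff_nhds]
  intro μ
  let _ := OrderState.lipMetric e L
  exact tendsto_iff_edist_tendsto_0.mpr (h μ)

end LipTopology

/-- The pullback of a state along a unital positive map. -/
def OrderState.comap {V W : Type*} [AddCommGroup V] [Module ℝ V] [PartialOrder V]
    [AddCommGroup W] [Module ℝ W] [PartialOrder W] {e : V} {e' : W} (T : W →ₗ[ℝ] V)
    (hT : ∀ a, 0 ≤ a → 0 ≤ T a) (he : T e' = e) (μ : OrderState V e) : OrderState W e' :=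
  ⟨μ.1 ∘ₗ T, fun a ha => μ.2.1 _ (hT a ha), by simp [he, μ.2.2]⟩

theorem OrderState.continuous_comap {V W : Type*} [AddCommGroup V] [Module ℝ V] [PartialOrder V]
    [AddCommGroup W] [Module ℝ W] [PartialOrder W] {e : V} {e' : W} (T : W →ₗ[ℝ] V)
    (hT : ∀ a, 0 ≤ a → 0 ≤ T a) (he : T e' = e) :
    @Continuous _ _ (OrderState.weakStar V e) (OrderState.weakStar W e')
      (OrderState.comap T hT he) := by
  let _ := OrderState.weakStar V e
  refine continuous_induced_rng.mpr (continuous_pi fun a => ?_)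
  exact (continuous_apply (T a)).comp continuous_induced_dom

theorem OrderState.tendsto_eval {V : Type*} [AddCommGroup V] [Module ℝ V] [PartialOrder V] {e : V}
    (μ : OrderState V e) (a : V) :
    Filter.Tendsto (fun ν : OrderState V e => ν.1 a) (@nhds _ (OrderState.weakStar V e) μ)
      (nhds (μ.1 a)) := by
  let _ := OrderState.weakStar V e
  exact ((continuous_apply a).comp continuous_induced_dom).tendsto μ

/-! ### The admissible seminorm given by an isomorphism -/

section GraphSeminorm

variable {A B : Type*} [CStarAlgebra A] [PartialOrder A] [StarOrderedRing A]
  [CStarAlgebra B] [PartialOrder B] [StarOrderedRing B]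
  (X : LipNormedOperatorSystem A) (Y : LipNormedOperatorSystem B)

/-- The first projection on the direct sum of the domains. -/
def domFst : X.dom.prod Y.dom →ₗ[ℝ] X.dom where
  toFun z := ⟨z.1.1, z.2.1⟩
  map_add' _ _ := rfl
  map_smul' _ _ := rfl

/-- The second projection on the direct sum of the domains. -/
def domSnd : X.dom.prod Y.dom →ₗ[ℝ] Y.dom where
  toFun z := ⟨z.1.2, z.2.2⟩
  map_add' _ _ := rfl
  map_smul' _ _ := rfl

variable {X Y} {Φ : X.toSubmodule ≃ₗ[ℂ] Y.toSubmodule}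

/-- The restriction of a Lip-isometric map to the domains of the Lip-norms. -/
noncomputable def IsLipIsometric.domMap (h : IsLipIsometric X Y Φ.toLinearMap) :
    X.dom →ₗ[ℝ] Y.dom where
  toFun x := ⟨Φ ⟨x, (X.dom_le x x.2).1⟩, (h ⟨x, (X.dom_le x x.2).1⟩ x.2).1⟩
  map_add' x y := by
    apply Subtype.ext
    exact congrArg (Subtype.val : Y.toSubmodule → B)
      (map_add Φ ⟨(x : A), (X.dom_le x x.2).1⟩ ⟨(y : A), (X.dom_le y y.2).1⟩)
  map_smul' c x := Subtype.ext (by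
    have h1 := congrArg Subtype.val (map_smul Φ (c : ℂ) ⟨(x : A), (X.dom_le x x.2).1⟩)
    have h2 : (⟨((c • x : X.dom) : A), (X.dom_le _ (c • x).2).1⟩ : X.toSubmodule) =
      (c : ℂ) • ⟨(x : A), (X.dom_le x x.2).1⟩ := Subtype.ext (Complex.coe_smul c (x : A)).symm
    simp only [h2]
    exact h1.trans (Complex.coe_smul _ _))

theorem IsLipIsometric.lip_domMap (h : IsLipIsometric X Y Φ.toLinearMap) (x : X.dom) :
    Y.lip (h.domMap x) = X.lip x := (h ⟨x, (X.dom_le x x.2).1⟩ x.2).2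

/-- The seminorm `max (L_X x) (L_Y y) (γ⁻¹ ‖Φ x - y‖)`. -/
noncomputable def graphSeminorm (h : IsLipIsometric X Y Φ.toLinearMap) (γ : ℝ) :
    Seminorm ℝ (X.dom.prod Y.dom) :=
  (X.lip.comp (domFst X Y) ⊔ Y.lip.comp (domSnd X Y)) ⊔
    (normSeminorm ℝ B).comp (γ⁻¹ • (Y.dom.subtype ∘ₗ (h.domMap ∘ₗ domFst X Y - domSnd X Y)))

theorem graphSeminorm_le_iff (h : IsLipIsometric X Y Φ.toLinearMap) {γ : ℝ} (hγ : 0 < γ)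
    (z : X.dom.prod Y.dom) (c : ℝ) : graphSeminorm h γ z ≤ c ↔
      X.lip (domFst X Y z) ≤ c ∧ Y.lip (domSnd X Y z) ≤ c ∧
        ‖((h.domMap (domFst X Y z) - domSnd X Y z : Y.dom) : B)‖ ≤ γ * c := by
  have h1 : (normSeminorm ℝ B).comp
      (γ⁻¹ • (Y.dom.subtype ∘ₗ (h.domMap ∘ₗ domFst X Y - domSnd X Y))) z =
      γ⁻¹ * ‖((h.domMap (domFst X Y z) - domSnd X Y z : Y.dom) : B)‖ := by
    change ‖γ⁻¹ • ((h.domMap (domFst X Y z) - domSnd X Y z : Y.dom) : B)‖ = _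
    rw [norm_smul, Real.norm_of_nonneg (inv_nonneg.mpr hγ.le)]
  rw [graphSeminorm, Seminorm.sup_apply, Seminorm.sup_apply, h1, sup_le_iff, sup_le_iff,
    inv_mul_le_iff₀ hγ, and_assoc]
  rfl

theorem domMap_one (h : IsLipIsometric X Y Φ.toLinearMap)
    (hu : Φ X.unit = Y.unit) :
    h.domMap ⟨1, X.one_mem_dom⟩ = ⟨1, Y.one_mem_dom⟩ :=
  Subtype.ext (congrArg (Subtype.val : Y.toSubmodule → B) hu)

theorem domMap_nonneg (h : IsLipIsometric X Y Φ.toLinearMap)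
    (hpos : IsNPositive 1 (Y.toSubmodule.subtype ∘ₗ Φ.toLinearMap)) (x : X.dom) (hx : 0 ≤ x) :
    0 ≤ h.domMap x :=
  hpos.nonneg (x := ⟨x, (X.dom_le x x.2).1⟩) hx

theorem graphSeminorm_one (h : IsLipIsometric X Y Φ.toLinearMap) {γ : ℝ} (hγ : 0 < γ)
    (hu : Φ X.unit = Y.unit) (z : X.dom.prod Y.dom) :
    graphSeminorm h γ z = 0 ↔ ∃ r : ℝ, z = r • ⟨(1, 1), ⟨X.one_mem_dom, Y.one_mem_dom⟩⟩ := by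
  rw [← (apply_nonneg _ _).ge_iff_eq', graphSeminorm_le_iff h hγ, mul_zero, norm_le_zero_iff,
    (apply_nonneg _ _).ge_iff_eq', (apply_nonneg _ _).ge_iff_eq',
    X.isLipNorm.eq_zero_iff, Y.isLipNorm.eq_zero_iff]
  constructor
  · rintro ⟨⟨r, hr⟩, -, h2⟩
    refine ⟨r, ?_⟩
    have h3 : domSnd X Y z = r • ⟨1, Y.one_mem_dom⟩ := by
      rw [← domMap_one h hu, ← map_smul, ← hr]
      exact (sub_eq_zero.mp (Subtype.ext h2)).symm
    exact Subtype.ext (Prod.ext (congrArg Subtype.val hr) (congrArg Subtype.val h3))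
  · rintro ⟨r, rfl⟩
    have e1 : domFst X Y (r • ⟨(1, 1), ⟨X.one_mem_dom, Y.one_mem_dom⟩⟩) =
      r • ⟨1, X.one_mem_dom⟩ := rfl
    have e2 : domSnd X Y (r • ⟨(1, 1), ⟨X.one_mem_dom, Y.one_mem_dom⟩⟩) =
      r • ⟨1, Y.one_mem_dom⟩ := rfl
    refine ⟨⟨r, e1⟩, ⟨r, e2⟩, ?_⟩
    rw [e1, e2, map_smul, domMap_one h hu, sub_self]
    rfl

/-- Convergence of states for the weak⋆ topology implies convergence for the metric of
`graphSeminorm`. For `z = (x, y)` in the unit ball one has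
`z = (x, Φ x) + (μ₀ (w) 1, w) - μ₀ (w) (1, 0)`, where `w = y - Φ x` and `μ₀` is a state; the first
two terms are images of elements of balls of `L_X` and `L_Y` under unital positive maps, and
`|μ₀ (w)| ≤ γ`. -/
theorem tendsto_edist_graphSeminorm (h : IsLipIsometric X Y Φ.toLinearMap) {γ : ℝ} (hγ : 0 < γ)
    (hu : Φ X.unit = Y.unit)
    (hpos : IsNPositive 1 (Y.toSubmodule.subtype ∘ₗ Φ.toLinearMap))
    (μ : OrderState (X.dom.prod Y.dom) ⟨(1, 1), ⟨X.one_mem_dom, Y.one_mem_dom⟩⟩) :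
    Filter.Tendsto (fun ν => (OrderState.lipMetric _ (graphSeminorm h γ)).edist ν μ)
      (@nhds _ (OrderState.weakStar _ _) μ) (nhds 0) := by
  have hsaY : ∀ y ∈ Y.dom, IsSelfAdjoint y := fun y hy => (Y.dom_le y hy).2
  let T₁ : X.dom →ₗ[ℝ] X.dom.prod Y.dom :=
    { toFun := fun x => ⟨(x, h.domMap x), ⟨x.2, (h.domMap x).2⟩⟩
      map_add' := fun x y => Subtype.ext (Prod.ext rfl (by simp))
      map_smul' := fun c x => Subtype.ext (Prod.ext rfl (by simp)) }
  have hT₁ : ∀ a, 0 ≤ a → 0 ≤ T₁ a := fun a ha => ⟨ha, domMap_nonneg h hpos a ha⟩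
  have hT₁u : T₁ ⟨1, X.one_mem_dom⟩ = ⟨(1, 1), ⟨X.one_mem_dom, Y.one_mem_dom⟩⟩ :=
    Subtype.ext (Prod.ext rfl (congrArg Subtype.val (domMap_one h hu)))
  have hlim₁ := (X.isLipNorm.tendsto_edist (OrderState.comap T₁ hT₁ hT₁u μ)).comp
    (@Continuous.tendsto _ _ (OrderState.weakStar _ _) (OrderState.weakStar _ _) _
      (OrderState.continuous_comap T₁ hT₁ hT₁u) μ)
  have hz₁ : ∀ {ν : OrderState (X.dom.prod Y.dom) ⟨(1, 1), ⟨X.one_mem_dom, Y.one_mem_dom⟩⟩}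
      {x : X.dom}, X.lip x ≤ 1 → ENNReal.ofReal |ν.1 (T₁ x) - μ.1 (T₁ x)| ≤
        (OrderState.lipMetric _ X.lip).edist (OrderState.comap T₁ hT₁ hT₁u ν)
          (OrderState.comap T₁ hT₁ hT₁u μ) := fun {ν x} hx =>
    le_iSup₂ (f := fun (a : X.dom) (_ : X.lip a ≤ 1) =>
      ENNReal.ofReal |(OrderState.comap T₁ hT₁ hT₁u ν).1 a -
        (OrderState.comap T₁ hT₁ hT₁u μ).1 a|) x hx
  rcases isEmpty_or_nonempty (OrderState Y.dom ⟨1, Y.one_mem_dom⟩) with hemp | ⟨⟨μ₀⟩⟩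
  · -- Without states, `Y` is zero and `z = (x, Φ x)`.
    refine tendsto_of_tendsto_of_tendsto_of_le_of_le tendsto_const_nhds hlim₁
      (fun _ => zero_le) fun ν => iSup₂_le fun z hz => ?_
    have hy : ∀ y : Y.dom, (y : B) = 0 := fun y => norm_le_zero_iff.mp
      (OrderState.norm_le_of_forall (h1 := Y.one_mem_dom) hsaY le_rfl fun μ => hemp.elim μ)
    have hzT : z = T₁ (domFst X Y z) :=
      Subtype.ext (Prod.ext rfl ((hy (domSnd X Y z)).trans (hy _).symm))
    rw [hzT]
    exact hz₁ ((graphSeminorm_le_iff h hγ z 1).mp hz).1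
  · let e₀ : X.dom.prod Y.dom := ⟨(1, 0), ⟨X.one_mem_dom, Y.dom.zero_mem⟩⟩
    let T₂ : Y.dom →ₗ[ℝ] X.dom.prod Y.dom :=
      { toFun := fun y => ⟨(μ₀.1 y • (1 : A), y), ⟨X.dom.smul_mem _ X.one_mem_dom, y.2⟩⟩
        map_add' := fun x y => Subtype.ext (Prod.ext (by simp [add_smul]) rfl)
        map_smul' := fun c x => Subtype.ext (Prod.ext (by simp [mul_smul]) rfl) }
    have hT₂ : ∀ a, 0 ≤ a → 0 ≤ T₂ a := fun a ha =>
      ⟨smul_nonneg (μ₀.2.1 a ha) zero_le_one, ha⟩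
    have hT₂u : T₂ ⟨1, Y.one_mem_dom⟩ = ⟨(1, 1), ⟨X.one_mem_dom, Y.one_mem_dom⟩⟩ :=
      Subtype.ext (Prod.ext (by simp [T₂, μ₀.2.2]) rfl)
    have hlim₂ := (Y.isLipNorm.tendsto_edist (OrderState.comap T₂ hT₂ hT₂u μ)).comp
      (@Continuous.tendsto _ _ (OrderState.weakStar _ _) (OrderState.weakStar _ _) _
        (OrderState.continuous_comap T₂ hT₂ hT₂u) μ)
    have hlim₃ : Filter.Tendsto (fun ν : OrderState (X.dom.prod Y.dom)
        ⟨(1, 1), ⟨X.one_mem_dom, Y.one_mem_dom⟩⟩ => ENNReal.ofReal (γ * |ν.1 e₀ - μ.1 e₀|))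
        (@nhds _ (OrderState.weakStar _ _) μ) (nhds 0) := by
      have := ENNReal.tendsto_ofReal
        (((OrderState.tendsto_eval μ e₀).sub_const (μ.1 e₀)).abs.const_mul γ)
      simpa using this
    have hlim := (hlim₁.add (ENNReal.Tendsto.const_mul (a := 2) hlim₂ (Or.inr (by simp)))).add hlim₃
    rw [mul_zero, add_zero, add_zero] at hlim
    refine tendsto_of_tendsto_of_tendsto_of_le_of_le tendsto_const_nhds hlim
      (fun _ => zero_le) fun ν => iSup₂_le fun z hz => ?_
    obtain ⟨hx, hy, hxy⟩ := (graphSeminorm_le_iff h hγ z 1).mp hz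
    set w : Y.dom := domSnd X Y z - h.domMap (domFst X Y z) with hwdef
    have hwL : Y.lip w ≤ 2 := by
      refine (map_sub_le_add Y.lip _ _).trans ?_
      rw [h.lip_domMap]
      linarith
    have hwn : ‖(w : B)‖ ≤ γ := by
      rw [mul_one] at hxy
      rwa [hwdef, Submodule.coe_sub, norm_sub_rev]
    have hdec : z = T₁ (domFst X Y z) + T₂ w - μ₀.1 w • e₀ := by
      refine Subtype.ext (Prod.ext ?_ ?_)
      · simp [T₁, T₂, e₀, domFst]
      · simp [T₁, T₂, e₀, hwdef, domSnd]
    have hw2 : ENNReal.ofReal |ν.1 (T₂ w) - μ.1 (T₂ w)| ≤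
        2 * (OrderState.lipMetric _ Y.lip).edist (OrderState.comap T₂ hT₂ hT₂u ν)
          (OrderState.comap T₂ hT₂ hT₂u μ) := by
      have h1 : Y.lip ((2 : ℝ)⁻¹ • w) ≤ 1 := by
        rw [map_smul_eq_mul, Real.norm_of_nonneg (by norm_num)]
        linarith
      have h2 := le_iSup₂ (f := fun (a : Y.dom) (_ : Y.lip a ≤ 1) =>
        ENNReal.ofReal |(OrderState.comap T₂ hT₂ hT₂u ν).1 a -
          (OrderState.comap T₂ hT₂ hT₂u μ).1 a|) _ h1
      have h3 : |ν.1 (T₂ w) - μ.1 (T₂ w)| = 2 * |(OrderState.comap T₂ hT₂ hT₂u ν).1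
          ((2 : ℝ)⁻¹ • w) - (OrderState.comap T₂ hT₂ hT₂u μ).1 ((2 : ℝ)⁻¹ • w)| := by
        rw [map_smul, map_smul, ← smul_sub, abs_smul]
        simp [OrderState.comap]
      rw [h3, ENNReal.ofReal_mul (by norm_num), ENNReal.ofReal_ofNat]
      exact mul_le_mul_right h2 _
    have hw3 : |μ₀.1 w * (ν.1 e₀ - μ.1 e₀)| ≤ γ * |ν.1 e₀ - μ.1 e₀| := by
      rw [abs_mul]
      exact mul_le_mul_of_nonneg_right
        ((OrderState.abs_le_norm hsaY μ₀ w).trans hwn) (abs_nonneg _)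
    have hsplit : |ν.1 z - μ.1 z| ≤ |ν.1 (T₁ (domFst X Y z)) - μ.1 (T₁ (domFst X Y z))| +
        |ν.1 (T₂ w) - μ.1 (T₂ w)| + γ * |ν.1 e₀ - μ.1 e₀| := by
      have h1 : ν.1 z - μ.1 z = (ν.1 (T₁ (domFst X Y z)) - μ.1 (T₁ (domFst X Y z))) +
          (ν.1 (T₂ w) - μ.1 (T₂ w)) - μ₀.1 w * (ν.1 e₀ - μ.1 e₀) := by
        conv_lhs => rw [hdec]
        simp only [map_add, map_sub, map_smul, smul_eq_mul]
        ring
      rw [h1]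
      exact (abs_sub _ _).trans (add_le_add (abs_add_le _ _) hw3)
    refine (ENNReal.ofReal_le_ofReal hsplit).trans ?_
    rw [ENNReal.ofReal_add (by positivity) (by positivity),
      ENNReal.ofReal_add (by positivity) (by positivity)]
    exact add_le_add (add_le_add (hz₁ hx) hw2) le_rfl

theorem isClosed_graphSeminorm_ball (h : IsLipIsometric X Y Φ.toLinearMap) {γ : ℝ} (hγ : 0 < γ)
    (hu : Φ X.unit = Y.unit)
    (hpos : IsNPositive 1 (Y.toSubmodule.subtype ∘ₗ Φ.toLinearMap)) :
    IsClosed {z : A × B | ∃ hz : z ∈ X.dom.prod Y.dom, graphSeminorm h γ ⟨z, hz⟩ ≤ 1} := by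
  have hcont : Continuous (Y.toSubmodule.subtype ∘ₗ Φ.toLinearMap) :=
    continuous_of_unital_positive (X := X.toOperatorSystem) (congrArg Subtype.val hu) hpos
  have hemb : Topology.IsClosedEmbedding
      (Prod.map (Subtype.val : X.toSubmodule → A) (id : B → B)) :=
    X.isClosed'.isClosedEmbedding_subtypeVal.prodMap .id
  have himg : {z : A × B | ∃ hz : z ∈ X.dom.prod Y.dom, graphSeminorm h γ ⟨z, hz⟩ ≤ 1} =
      Prod.map (Subtype.val : X.toSubmodule → A) (id : B → B) ''
        {w | (w.1 : A) ∈ {x : A | ∃ hx : x ∈ X.dom, X.lip ⟨x, hx⟩ ≤ 1} ∧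
          w.2 ∈ {y : B | ∃ hy : y ∈ Y.dom, Y.lip ⟨y, hy⟩ ≤ 1} ∧
          ‖(Y.toSubmodule.subtype ∘ₗ Φ.toLinearMap) w.1 - w.2‖ ≤ γ} := by
    ext ⟨x, y⟩
    constructor
    · rintro ⟨hz, hL⟩
      obtain ⟨h1, h2, h3⟩ := (graphSeminorm_le_iff h hγ _ 1).mp hL
      rw [mul_one] at h3
      exact ⟨(⟨x, (X.dom_le x hz.1).1⟩, y), ⟨⟨hz.1, h1⟩, ⟨hz.2, h2⟩, h3⟩, rfl⟩
    · rintro ⟨⟨x', y'⟩, ⟨⟨hx, h1⟩, ⟨hy, h2⟩, h3⟩, heq⟩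
      obtain ⟨rfl, rfl⟩ := Prod.mk.inj heq
      refine ⟨⟨hx, hy⟩, (graphSeminorm_le_iff h hγ _ 1).mpr ⟨h1, h2, ?_⟩⟩
      rw [mul_one]
      exact h3
  rw [himg]
  refine hemb.isClosedMap _ ?_
  refine .inter (X.isClosed_unitBall.preimage (continuous_subtype_val.comp continuous_fst))
    (.inter (Y.isClosed_unitBall.preimage continuous_snd) ?_)
  exact isClosed_le ((hcont.comp continuous_fst).sub continuous_snd).norm continuous_const

theorem isAdmissible_graphSeminorm (h : IsBiLipIsometric X Y Φ) {γ : ℝ} (hγ : 0 < γ)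
    (hu : Φ X.unit = Y.unit)
    (hpos : IsNPositive 1 (Y.toSubmodule.subtype ∘ₗ Φ.toLinearMap)) :
    IsAdmissible X Y (graphSeminorm h.1 γ) where
  isLipNorm :=
    { eq_zero_iff := graphSeminorm_one h.1 hγ hu
      induces_weakStar := le_antisymm
        (OrderState.lipMetric_le_weakStar fun z => (graphSeminorm_one h.1 hγ hu z).mp)
        (OrderState.weakStar_le_lipMetric (tendsto_edist_graphSeminorm h.1 hγ hu hpos)) }
  isClosed_unitBall := isClosed_graphSeminorm_ball h.1 hγ hu hpos
  induces_left x := by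
    refine ⟨?_, fun c hc => ?_⟩
    · rintro _ ⟨y, rfl⟩
      exact ((graphSeminorm_le_iff h.1 hγ ⟨(x, y), ⟨x.2, y.2⟩⟩ _).mp le_rfl).1
    · refine (hc ⟨h.1.domMap x, rfl⟩).trans ((graphSeminorm_le_iff h.1 hγ _ _).mpr
        ⟨le_rfl, (h.1.lip_domMap x).le, ?_⟩)
      change ‖((h.1.domMap x - h.1.domMap x : Y.dom) : B)‖ ≤ _
      rw [sub_self, Submodule.coe_zero, norm_zero]
      exact mul_nonneg hγ.le (apply_nonneg _ _)
  induces_right y := by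
    refine ⟨?_, fun c hc => ?_⟩
    · rintro _ ⟨x, rfl⟩
      exact ((graphSeminorm_le_iff h.1 hγ ⟨(x, y), ⟨x.2, y.2⟩⟩ _).mp le_rfl).2.1
    · obtain ⟨hx, hL⟩ := h.2 ⟨y, (Y.dom_le y y.2).1⟩ y.2
      refine (hc ⟨⟨_, hx⟩, rfl⟩).trans ((graphSeminorm_le_iff h.1 hγ _ _).mpr
        ⟨hL.le, le_rfl, ?_⟩)
      have h1 : h.1.domMap ⟨_, hx⟩ = y := Subtype.ext (congrArg (Subtype.val : Y.toSubmodule → B)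
        (Φ.apply_symm_apply ⟨y, (Y.dom_le y y.2).1⟩))
      change ‖((h.1.domMap ⟨_, hx⟩ - y : Y.dom) : B)‖ ≤ _
      rw [h1, sub_self, Submodule.coe_zero, norm_zero]
      exact mul_nonneg hγ.le (apply_nonneg _ _)

/-- For the admissible seminorm of `Φ` with parameter `γ`, every unital completely positive map is
at distance at most `γ` from its transport along `Φ`. -/
theorem ucpHausdorff_graphSeminorm_le (h : IsBiLipIsometric X Y Φ) {γ : ℝ} (hγ : 0 < γ)
    (hu : Φ X.unit = Y.unit) {n : ℕ}
    (hX : ∀ φ : UCP X.toOperatorSystem n, IsCP (φ.1 ∘ₗ Φ.symm.toLinearMap))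
    (hY : ∀ ψ : UCP Y.toOperatorSystem n, IsCP (ψ.1 ∘ₗ Φ.toLinearMap)) :
    ucpHausdorff X Y (graphSeminorm h.1 γ) n ≤ ENNReal.ofReal γ := by
  have hu' : Φ.symm Y.unit = X.unit := by rw [← hu, Φ.symm_apply_apply]
  let _ := UCP.lipMetric (X.toOperatorSystem.prod Y.toOperatorSystem) (graphSeminorm h.1 γ) n
  have key : ∀ (φ : UCP X.toOperatorSystem n) (ψ : UCP Y.toOperatorSystem n),
      (∀ x, φ.1 x = ψ.1 (Φ x)) → edist (UCP.inl X.toOperatorSystem Y.toOperatorSystem n φ)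
        (UCP.inr X.toOperatorSystem Y.toOperatorSystem n ψ) ≤ ENNReal.ofReal γ := by
    intro φ ψ hφψ
    refine iSup_le ?_
    rintro ⟨⟨⟨x, y⟩, hx', hy'⟩, ⟨hx, hy⟩, hL⟩
    have h3 := ((graphSeminorm_le_iff h.1 hγ _ 1).mp hL).2.2
    rw [mul_one] at h3
    rw [← ofReal_norm]
    refine ENNReal.ofReal_le_ofReal ?_
    change ‖φ.1 ⟨x, hx'⟩ - ψ.1 ⟨y, hy'⟩‖ ≤ γ
    rw [hφψ, ← map_sub]
    refine (norm_map_le ψ.2.1 (ψ.2.2 1) ?_).trans h3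
    exact (Y.dom_le _ (h.1.domMap ⟨x, hx⟩ - ⟨y, hy⟩).2).2
  refine Metric.hausdorffEDist_le_of_mem_edist ?_ ?_
  · rintro _ ⟨φ, rfl⟩
    refine ⟨_, ⟨⟨φ.1 ∘ₗ Φ.symm.toLinearMap, ?_, hX φ⟩, rfl⟩, key _ _ fun x => ?_⟩
    · change φ.1 (Φ.symm Y.unit) = 1
      rw [hu', φ.2.1]
    · change φ.1 x = φ.1 (Φ.symm (Φ x))
      rw [Φ.symm_apply_apply]
  · rintro _ ⟨ψ, rfl⟩
    refine ⟨_, ⟨⟨ψ.1 ∘ₗ Φ.toLinearMap, ?_, hY ψ⟩, rfl⟩, ?_⟩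
    · change ψ.1 (Φ X.unit) = 1
      rw [hu, ψ.2.1]
    · rw [edist_comm]
      exact key _ _ fun x => rfl

end GraphSeminorm

/-! ### The asymptotic graph of a sequence of relations between UCP maps -/

section AsymptoticGraph

variable {A B : Type*} [CStarAlgebra A] [PartialOrder A] [StarOrderedRing A]
  [CStarAlgebra B] [PartialOrder B] [StarOrderedRing B]

/-- The pairs `(x, y)` on which `P k`-related unital completely positive maps agree
asymptotically, uniformly over all related pairs of maps, as `k` tends to infinity along `l`. -/
def asymptoticGraph (X : OperatorSystem A) (Y : OperatorSystem B)
    (P : ℕ → ∀ n : ℕ, UCP X n → UCP Y n → Prop) (l : Filter ℕ) :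
    Submodule ℂ (X.toSubmodule × Y.toSubmodule) where
  carrier := {z | ∀ η : ℝ, 0 < η → ∀ᶠ k in l, ∀ (n : ℕ) (φ : UCP X n) (ψ : UCP Y n),
    P k n φ ψ → ‖φ.1 z.1 - ψ.1 z.2‖ ≤ η}
  add_mem' := by
    intro z w hz hw η hη
    filter_upwards [hz (η / 2) (half_pos hη), hw (η / 2) (half_pos hη)] with k h1 h2 n φ ψ hP
    have : φ.1 (z + w).1 - ψ.1 (z + w).2 = (φ.1 z.1 - ψ.1 z.2) + (φ.1 w.1 - ψ.1 w.2) := by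
      rw [Prod.fst_add, Prod.snd_add, map_add, map_add]
      abel
    rw [this]
    exact (norm_add_le _ _).trans (by linarith [h1 n φ ψ hP, h2 n φ ψ hP])
  zero_mem' := by
    intro η hη
    exact .of_forall fun k n φ ψ _ => by simpa using hη.le
  smul_mem' := by
    intro c z hz η hη
    filter_upwards [hz (η / (‖c‖ + 1)) (by positivity)] with k h n φ ψ hP
    have : φ.1 (c • z).1 - ψ.1 (c • z).2 = c • (φ.1 z.1 - ψ.1 z.2) := by
      rw [Prod.smul_fst, Prod.smul_snd, map_smul, map_smul, smul_sub]
    rw [this, norm_smul]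
    calc ‖c‖ * ‖φ.1 z.1 - ψ.1 z.2‖ ≤ (‖c‖ + 1) * (η / (‖c‖ + 1)) :=
          mul_le_mul (by linarith) (h n φ ψ hP) (norm_nonneg _) (by positivity)
      _ = η := by field_simp

variable {X : OperatorSystem A} {Y : OperatorSystem B}
  {P : ℕ → ∀ n : ℕ, UCP X n → UCP Y n → Prop} {l : Filter ℕ}

theorem mem_asymptoticGraph {z : X.toSubmodule × Y.toSubmodule} :
    z ∈ asymptoticGraph X Y P l ↔ ∀ η : ℝ, 0 < η → ∀ᶠ k in l, ∀ (n : ℕ) (φ : UCP X n)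
      (ψ : UCP Y n), P k n φ ψ → ‖φ.1 z.1 - ψ.1 z.2‖ ≤ η := Iff.rfl

theorem swap_mem_asymptoticGraph {x : X.toSubmodule} {y : Y.toSubmodule} :
    (y, x) ∈ asymptoticGraph Y X (fun k n ψ φ => P k n φ ψ) l ↔
      (x, y) ∈ asymptoticGraph X Y P l := by
  simp only [mem_asymptoticGraph]
  constructor
  · intro h η hη
    filter_upwards [h η hη] with k h1 n φ ψ hP
    rw [norm_sub_rev]
    exact h1 n ψ φ hP
  · intro h η hη
    filter_upwards [h η hη] with k h1 n φ ψ hP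
    rw [norm_sub_rev]
    exact h1 n ψ φ hP

theorem unit_mem_asymptoticGraph : (X.unit, Y.unit) ∈ asymptoticGraph X Y P l := by
  intro η hη
  refine .of_forall fun k n φ ψ _ => ?_
  rw [φ.2.1, ψ.2.1, sub_self, norm_zero]
  exact hη.le

theorem isClosed_asymptoticGraph :
    IsClosed (asymptoticGraph X Y P l : Set (X.toSubmodule × Y.toSubmodule)) := by
  refine isClosed_of_closure_subset fun z hz η hη => ?_
  -- The maps are bounded by `2`, so the error is at most `η / 4 + η / 2 + η / 4`.
  obtain ⟨w, hw, hzw⟩ := Metric.mem_closure_iff.mp hz (η / 8) (by positivity)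
  filter_upwards [hw (η / 2) (by positivity)] with k h n φ ψ hP
  have e1 : ‖φ.1 (z.1 - w.1)‖ ≤ 2 * ‖z.1 - w.1‖ := norm_map_le_two_mul φ.2.1 (φ.2.2 1) _
  have e2 : ‖ψ.1 (z.2 - w.2)‖ ≤ 2 * ‖z.2 - w.2‖ := norm_map_le_two_mul ψ.2.1 (ψ.2.2 1) _
  have e3 : ‖z.1 - w.1‖ ≤ η / 8 := (norm_fst_le (z - w)).trans (dist_eq_norm z w ▸ hzw.le)
  have e4 : ‖z.2 - w.2‖ ≤ η / 8 := (norm_snd_le (z - w)).trans (dist_eq_norm z w ▸ hzw.le)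
  have e5 : φ.1 z.1 - ψ.1 z.2 =
      φ.1 (z.1 - w.1) + (φ.1 w.1 - ψ.1 w.2) - ψ.1 (z.2 - w.2) := by
    rw [map_sub, map_sub]
    abel
  rw [e5]
  refine (norm_sub_le _ _).trans ?_
  have e6 := norm_add_le (φ.1 (z.1 - w.1)) (φ.1 w.1 - ψ.1 w.2)
  linarith [h n φ ψ hP]

theorem star_mem_asymptoticGraph {x : X.toSubmodule} {y : Y.toSubmodule}
    (h : (x, y) ∈ asymptoticGraph X Y P l) :
    ((⟨star (x : A), X.star_mem' x.2⟩, ⟨star (y : B), Y.star_mem' y.2⟩) :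
      X.toSubmodule × Y.toSubmodule) ∈ asymptoticGraph X Y P l := by
  intro η hη
  filter_upwards [h η hη] with k h1 n φ ψ hP
  rw [map_star_of_positive φ.2.1 (φ.2.2 1), map_star_of_positive ψ.2.1 (ψ.2.2 1), ← star_sub,
    norm_star]
  exact h1 n φ ψ hP

theorem parts_mem_asymptoticGraph {x a b : X.toSubmodule} {y c d : Y.toSubmodule}
    (hx : x = a + Complex.I • b) (hy : y = c + Complex.I • d) (ha : IsSelfAdjoint (a : A))
    (hb : IsSelfAdjoint (b : A)) (hc : IsSelfAdjoint (c : B)) (hd : IsSelfAdjoint (d : B))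
    (h : (x, y) ∈ asymptoticGraph X Y P l) :
    (a, c) ∈ asymptoticGraph X Y P l ∧ (b, d) ∈ asymptoticGraph X Y P l := by
  have hs := star_mem_asymptoticGraph h
  have hx' : (⟨star (x : A), X.star_mem' x.2⟩ : X.toSubmodule) = a - Complex.I • b := by
    apply Subtype.ext
    simp [hx, ha.star_eq, hb.star_eq, sub_eq_add_neg]
  have hy' : (⟨star (y : B), Y.star_mem' y.2⟩ : Y.toSubmodule) = c - Complex.I • d := by
    apply Subtype.ext
    simp [hy, hc.star_eq, hd.star_eq, sub_eq_add_neg]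
  rw [hx', hy'] at hs
  rw [hx, hy] at h
  constructor
  · have h1 := (asymptoticGraph X Y P l).smul_mem (2⁻¹ : ℂ) (add_mem h hs)
    convert h1 using 1
    refine Prod.ext ?_ ?_ <;> simp only [Prod.smul_fst, Prod.smul_snd, Prod.fst_add, Prod.snd_add]
      <;> module
  · have h1 := (asymptoticGraph X Y P l).smul_mem (-Complex.I * 2⁻¹ : ℂ) (sub_mem h hs)
    convert h1 using 1
    have hI : (-Complex.I * 2⁻¹) * (2 * Complex.I) = (1 : ℂ) := by
      linear_combination -Complex.I_mul_I
    refine Prod.ext ?_ ?_ <;> simp only [Prod.smul_fst, Prod.smul_snd, Prod.fst_sub, Prod.snd_sub]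
    · rw [show a + Complex.I • b - (a - Complex.I • b) = (2 * Complex.I) • b by module, smul_smul,
        hI, one_smul]
    · rw [show c + Complex.I • d - (c - Complex.I • d) = (2 * Complex.I) • d by module, smul_smul,
        hI, one_smul]

variable [l.NeBot]

/-- The asymptotic graph transports positivity of matrices from `X` to `Y` when every unital
completely positive map on `Y` is related to one on `X`. -/
theorem toCStarMatrix_nonneg_of_mem_asymptoticGraph {m n : ℕ} (hmn : m ≤ n)
    (hP : ∀ k, ∀ ψ : UCP Y n, ∃ φ : UCP X n, P k n φ ψ)
    {M : Matrix (Fin m) (Fin m) X.toSubmodule} {N : Matrix (Fin m) (Fin m) Y.toSubmodule}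
    (hMN : ∀ i j, (M i j, N i j) ∈ asymptoticGraph X Y P l) (hM : 0 ≤ toCStarMatrix M) :
    0 ≤ toCStarMatrix N := by
  refine toCStarMatrix_nonneg_of_forall_ucp Y hmn N fun ψ => ?_
  choose φ hφ using fun k => hP k ψ
  have hlim : Filter.Tendsto (fun k => (CStarMatrix.ofMatrix (M.map fun x => (φ k).1 x) :
      CStarMatrix (Fin m) (Fin m) (CStarMatrix (Fin n) (Fin n) ℂ))) l
      (nhds (CStarMatrix.ofMatrix (N.map fun x => ψ.1 x))) := by
    refine tendsto_pi_nhds.mpr fun i => tendsto_pi_nhds.mpr fun j => ?_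
    rw [Metric.tendsto_nhds]
    intro ε hε
    filter_upwards [hMN i j (ε / 2) (half_pos hε)] with k hk
    rw [dist_eq_norm]
    exact (hk n (φ k) ψ (hφ k)).trans_lt (half_lt_self hε)
  exact CStarAlgebra.isClosed_nonneg.mem_of_tendsto hlim
    (.of_forall fun k => (φ k).2.2 m M hM)

theorem norm_le_of_mem_asymptoticGraph {n : ℕ} (hn : 1 ≤ n)
    (hP : ∀ k, ∀ ψ : UCP Y n, ∃ φ : UCP X n, P k n φ ψ) {x : X.toSubmodule} {y : Y.toSubmodule}
    (hx : IsSelfAdjoint (x : A)) (hy : IsSelfAdjoint (y : B))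
    (h : (x, y) ∈ asymptoticGraph X Y P l) : ‖(y : B)‖ ≤ ‖(x : A)‖ := by
  refine norm_le_of_forall_ucp Y hn hy (norm_nonneg _) fun ψ => le_of_forall_pos_le_add
    fun η hη => ?_
  obtain ⟨k, hk⟩ := (h η hη).exists
  obtain ⟨φ, hφ⟩ := hP k ψ
  have e1 := hk n φ ψ hφ
  have e2 := norm_map_le φ.2.1 (φ.2.2 1) hx
  have e3 := norm_sub_norm_le (ψ.1 y) (φ.1 x)
  rw [norm_sub_rev] at e3
  linarith

theorem norm_le_two_mul_of_mem_asymptoticGraph {n : ℕ} (hn : 1 ≤ n)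
    (hP : ∀ k, ∀ ψ : UCP Y n, ∃ φ : UCP X n, P k n φ ψ) {x : X.toSubmodule} {y : Y.toSubmodule}
    (h : (x, y) ∈ asymptoticGraph X Y P l) : ‖(y : B)‖ ≤ 2 * ‖(x : A)‖ := by
  obtain ⟨a, b, ha, hb, hax, hbx, hx⟩ := X.exists_add_I_smul x
  obtain ⟨c, d, hc, hd, -, -, hy⟩ := Y.exists_add_I_smul y
  obtain ⟨h1, h2⟩ := parts_mem_asymptoticGraph hx hy ha hb hc hd h
  have e1 := norm_le_of_mem_asymptoticGraph hn hP ha hc h1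
  have e2 := norm_le_of_mem_asymptoticGraph hn hP hb hd h2
  rw [hax] at e1
  rw [hbx] at e2
  have e3 : ‖(realPart (x : A) : A)‖ ≤ ‖(x : A)‖ := realPart.norm_le (x : A)
  have e4 : ‖(imaginaryPart (x : A) : A)‖ ≤ ‖(x : A)‖ := imaginaryPart.norm_le (x : A)
  have e5 : ‖(y : B)‖ ≤ ‖(c : B)‖ + ‖(d : B)‖ := by
    rw [hy]
    refine (norm_add_le (c : B) (Complex.I • (d : B))).trans ?_
    rw [norm_smul, Complex.norm_I, one_mul]
  linarith

theorem eq_of_mem_asymptoticGraph {n : ℕ} (hn : 1 ≤ n)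
    (hP : ∀ k, ∀ ψ : UCP Y n, ∃ φ : UCP X n, P k n φ ψ) {x : X.toSubmodule}
    {y y' : Y.toSubmodule} (h : (x, y) ∈ asymptoticGraph X Y P l)
    (h' : (x, y') ∈ asymptoticGraph X Y P l) : y = y' := by
  have h1 := sub_mem h h'
  rw [Prod.mk_sub_mk, sub_self] at h1
  have h2 := norm_le_two_mul_of_mem_asymptoticGraph hn hP h1
  rw [Submodule.coe_zero, norm_zero, mul_zero, norm_le_zero_iff] at h2
  exact sub_eq_zero.mp (Subtype.ext h2)

/-- If the projection of the asymptotic graph to `X` contains a subset `D` that is dense in the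
self-adjoint part of `X`, it is all of `X`: the graph is complete and its projection to `X` is
bounded below. -/
theorem exists_mem_asymptoticGraph {n : ℕ} (hn : 1 ≤ n)
    (hP : ∀ k, ∀ ψ : UCP Y n, ∃ φ : UCP X n, P k n φ ψ) {D : Set A}
    (hDX : ∀ x ∈ D, x ∈ X.toSubmodule)
    (hD : ∀ x ∈ X.toSubmodule, IsSelfAdjoint x → x ∈ closure D)
    (hG : ∀ (x : A) (hx : x ∈ D), ∃ y : Y.toSubmodule,
      (⟨x, hDX x hx⟩, y) ∈ asymptoticGraph X Y P l) (x : X.toSubmodule) :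
    ∃ y : Y.toSubmodule, (x, y) ∈ asymptoticGraph X Y P l := by
  set G := asymptoticGraph X Y P l with hGdef
  have : CompleteSpace X.toSubmodule := X.isClosed'.completeSpace_coe
  have : CompleteSpace Y.toSubmodule := Y.isClosed'.completeSpace_coe
  have : CompleteSpace G := isClosed_asymptoticGraph.completeSpace_coe
  let p : G →ₗ[ℂ] X.toSubmodule := LinearMap.fst ℂ _ _ ∘ₗ G.subtype
  have hanti : AntilipschitzWith 2 p := by
    refine AddMonoidHomClass.antilipschitz_of_bound p fun z => ?_
    refine max_le ?_ (norm_le_two_mul_of_mem_asymptoticGraph hn hP z.2)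
    have : ‖z.1.1‖ ≤ 2 * ‖z.1.1‖ := by linarith [norm_nonneg z.1.1]
    exact this
  have hcl : IsClosed (Set.range p) := hanti.isClosed_range
    (uniformContinuous_fst.comp uniformContinuous_subtype_val)
  have hsa : ∀ a : X.toSubmodule, IsSelfAdjoint (a : A) → a ∈ LinearMap.range p := by
    intro a ha
    have h1 : a ∈ closure {x : X.toSubmodule | (x : A) ∈ D} := by
      rw [closure_subtype]
      refine closure_mono ?_ (hD a a.2 ha)
      exact fun x hx => ⟨⟨x, hDX x hx⟩, hx, rfl⟩
    refine closure_minimal ?_ hcl h1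
    intro x hx
    obtain ⟨y, hy⟩ := hG x hx
    exact ⟨⟨_, hy⟩, rfl⟩
  obtain ⟨a, b, ha, hb, -, -, hx⟩ := X.exists_add_I_smul x
  have hmem : x ∈ LinearMap.range p :=
    hx ▸ add_mem (hsa a ha) (Submodule.smul_mem _ _ (hsa b hb))
  obtain ⟨⟨⟨x', y⟩, hz⟩, rfl⟩ := hmem
  exact ⟨y, hz⟩

end AsymptoticGraph

/-! ### The isomorphism obtained from vanishing Hausdorff distances -/

section Limit

variable {A B : Type*} [CStarAlgebra A] [PartialOrder A] [StarOrderedRing A]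
  [CStarAlgebra B] [PartialOrder B] [StarOrderedRing B]
  {X : LipNormedOperatorSystem A} {Y : LipNormedOperatorSystem B}

/-- Every element `x` of the domain of `L_X` is related by the asymptotic graph to an element `y` of
the domain of `L_Y` with `L_Y y ≤ L_X x`. One chooses `yₖ` with `Nₖ(x, yₖ) < L_X x + 1 / (k + 1)`;
these lie in a compact set, and `y` is their limit along the ultrafilter. -/
theorem exists_dom_mem_asymptoticGraph
    {P : ℕ → ∀ n : ℕ, UCP X.toOperatorSystem n → UCP Y.toOperatorSystem n → Prop}
    {l : Ultrafilter ℕ} (hl : (l : Filter ℕ) ≤ Filter.atTop) {n : ℕ} (hn : 1 ≤ n)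
    (hP : ∀ k, ∀ ψ : UCP Y.toOperatorSystem n, ∃ φ : UCP X.toOperatorSystem n, P k n φ ψ)
    {N : ℕ → X.dom → Y.dom → ℝ}
    (hN : ∀ k x c, X.lip x < c → ∃ y, N k x y < c) (hNY : ∀ k x y, Y.lip y ≤ N k x y)
    (hPN : ∀ k n φ ψ, P k n φ ψ → ∀ (x : X.dom) (y : Y.dom) (C : ℝ), 0 < C → N k x y ≤ C →
      ‖φ.1 ⟨x, (X.dom_le x x.2).1⟩ - ψ.1 ⟨y, (Y.dom_le y y.2).1⟩‖ ≤ C / (k + 1))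
    (x : X.dom) : ∃ y : Y.dom, Y.lip y ≤ X.lip x ∧
      ((⟨x, (X.dom_le x x.2).1⟩, ⟨y, (Y.dom_le y y.2).1⟩) : X.toSubmodule × Y.toSubmodule) ∈
        asymptoticGraph X.toOperatorSystem Y.toOperatorSystem P l := by
  have hx0 : 0 ≤ X.lip x := apply_nonneg _ _
  choose y hy using fun k : ℕ => hN k x (X.lip x + 1 / ((k : ℝ) + 1))
    (lt_add_of_pos_right _ (by positivity))
  have hk1 : ∀ k : ℕ, 1 / ((k : ℝ) + 1) ≤ 1 := fun k => by
    rw [div_le_one (by positivity)]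
    linarith [k.cast_nonneg (α := ℝ)]
  have hyN : ∀ k, N k x (y k) ≤ X.lip x + 1 := fun k => by linarith [hy k, hk1 k]
  have hdist : ∀ k n φ ψ, P k n φ ψ →
      ‖φ.1 ⟨x, (X.dom_le x x.2).1⟩ - ψ.1 ⟨y k, (Y.dom_le _ (y k).2).1⟩‖ ≤
        (X.lip x + 1) / (k + 1) := fun k n φ ψ h =>
    hPN k n φ ψ h x (y k) _ (by linarith) (hyN k)
  have hynorm : ∀ k, ‖(y k : B)‖ ≤ ‖(x : A)‖ + (X.lip x + 1) := by
    intro k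
    refine norm_le_of_forall_ucp Y.toOperatorSystem hn
      (x := ⟨y k, (Y.dom_le _ (y k).2).1⟩) (Y.dom_le _ (y k).2).2 (by positivity) fun ψ => ?_
    obtain ⟨φ, hφ⟩ := hP k ψ
    have e1 := hdist k n φ ψ hφ
    have e2 := norm_map_le φ.2.1 (φ.2.2 1) (x := ⟨x, (X.dom_le x x.2).1⟩) (X.dom_le x x.2).2
    have e3 := norm_sub_norm_le (ψ.1 ⟨y k, (Y.dom_le _ (y k).2).1⟩)
      (φ.1 ⟨x, (X.dom_le x x.2).1⟩)
    rw [norm_sub_rev] at e3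
    have e4 : (X.lip x + 1) / ((k : ℝ) + 1) ≤ X.lip x + 1 :=
      div_le_self (by linarith) (by linarith [k.cast_nonneg (α := ℝ)])
    have e5 : ‖((⟨x, (X.dom_le x x.2).1⟩ : X.toSubmodule) : A)‖ = ‖(x : A)‖ := rfl
    linarith
  have hcpt := isCompact_lipBall (fun y hy => (Y.dom_le y hy).2) Y.isLipNorm Y.isClosed_unitBall
    (C := X.lip x + 1) (by linarith) (‖(x : A)‖ + (X.lip x + 1))
  obtain ⟨y₀, ⟨⟨hy₀, -⟩, -⟩, hlim⟩ := hcpt.ultrafilter_le_nhds (l.map fun k => (y k : B)) 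
    (Filter.tendsto_principal.mpr (.of_forall fun k =>
      ⟨⟨(y k).2, (hNY k x (y k)).trans (hyN k)⟩, hynorm k⟩))
  have hlim' : Filter.Tendsto (fun k => (y k : B)) l (nhds y₀) := hlim
  have hinv : Filter.Tendsto (fun k : ℕ => 1 / ((k : ℝ) + 1)) l (nhds 0) :=
    tendsto_one_div_add_atTop_nhds_zero_nat.mono_left hl
  refine ⟨⟨y₀, hy₀⟩, le_of_forall_pos_le_add fun ε hε => ?_, fun η hη => ?_⟩
  · have hcl := isClosed_lipBall Y.isClosed_unitBall (C := X.lip x + ε) (by linarith)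
    obtain ⟨_, h⟩ := hcl.mem_of_tendsto hlim' (by
      filter_upwards [hinv.eventually_lt_const hε] with k hk
      exact ⟨(y k).2, by linarith [hNY k x (y k), hy k]⟩)
    exact h
  · have h1 : ∀ᶠ k : ℕ in (l : Filter ℕ), (X.lip x + 1) * (1 / ((k : ℝ) + 1)) < η / 2 := by
      have := hinv.const_mul (X.lip x + 1)
      rw [mul_zero] at this
      exact this.eventually_lt_const (half_pos hη)
    have h2 : ∀ᶠ k : ℕ in (l : Filter ℕ), ‖(y k : B) - y₀‖ < η / 2 := by
      have := (Metric.tendsto_nhds.mp hlim') (η / 2) (half_pos hη)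
      simpa only [dist_eq_norm] using this
    filter_upwards [h1, h2] with k hk1 hk2 n φ ψ hφ
    have e1 := hdist k n φ ψ hφ
    have e2 := norm_map_le ψ.2.1 (ψ.2.2 1)
      (x := ⟨y k, (Y.dom_le _ (y k).2).1⟩ - ⟨y₀, (Y.dom_le _ hy₀).1⟩)
      (Y.dom_le _ (y k - ⟨y₀, hy₀⟩).2).2
    rw [map_sub] at e2
    have e3 := norm_sub_le_norm_sub_add_norm_sub (φ.1 ⟨x, (X.dom_le x x.2).1⟩)
      (ψ.1 ⟨y k, (Y.dom_le _ (y k).2).1⟩) (ψ.1 ⟨y₀, (Y.dom_le _ hy₀).1⟩)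
    rw [mul_one_div] at hk1
    refine e3.trans ?_
    have e4 := e2.trans hk2.le
    linarith

theorem LinearEquiv.exists_forall_mem_of_graph {V W : Type*} [AddCommGroup V] [Module ℂ V]
    [AddCommGroup W] [Module ℂ W] {G : Submodule ℂ (V × W)}
    (huW : ∀ {x y y'}, (x, y) ∈ G → (x, y') ∈ G → y = y')
    (huV : ∀ {x x' y}, (x, y) ∈ G → (x', y) ∈ G → x = x')
    (hV : ∀ x, ∃ y, (x, y) ∈ G) (hW : ∀ y, ∃ x, (x, y) ∈ G) :
    ∃ Φ : V ≃ₗ[ℂ] W, ∀ x, (x, Φ x) ∈ G := by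
  choose f hf using hV
  choose g hg using hW
  exact ⟨{ toFun := f
           invFun := g
           map_add' := fun x y => huW (hf _) (G.add_mem (hf x) (hf y))
           map_smul' := fun c x => huW (hf _) (G.smul_mem c (hf x))
           left_inv := fun x => huV (hg _) (hf x)
           right_inv := fun y => huW (hf _) (hg y) }, hf⟩

/-- Relations `P k` between unital completely positive maps on `X` and on `Y` that are surjective in
both directions, and whose pairs agree within `C / (k + 1)` on the pairs `(x, y)` with
`Nₖ(x, y) ≤ C`, determine an isomorphism of `X` and `Y`: its graph is their asymptotic graph. -/
theorem exists_equiv_of_relations {S : Set ℕ} (hS : S.Nonempty) (hS1 : ∀ n ∈ S, 1 ≤ n)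
    {P : ℕ → ∀ n : ℕ, UCP X.toOperatorSystem n → UCP Y.toOperatorSystem n → Prop}
    (hPX : ∀ n ∈ S, ∀ k, ∀ ψ : UCP Y.toOperatorSystem n,
      ∃ φ : UCP X.toOperatorSystem n, P k n φ ψ)
    (hPY : ∀ n ∈ S, ∀ k, ∀ φ : UCP X.toOperatorSystem n,
      ∃ ψ : UCP Y.toOperatorSystem n, P k n φ ψ)
    {N : ℕ → X.dom → Y.dom → ℝ}
    (hN : ∀ k x c, X.lip x < c → ∃ y, N k x y < c) (hNX : ∀ k x y, X.lip x ≤ N k x y)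
    (hN' : ∀ k y c, Y.lip y < c → ∃ x, N k x y < c) (hNY : ∀ k x y, Y.lip y ≤ N k x y)
    (hPN : ∀ k n φ ψ, P k n φ ψ → ∀ (x : X.dom) (y : Y.dom) (C : ℝ), 0 < C → N k x y ≤ C →
      ‖φ.1 ⟨x, (X.dom_le x x.2).1⟩ - ψ.1 ⟨y, (Y.dom_le y y.2).1⟩‖ ≤ C / (k + 1)) :
    ∃ Φ : X.toSubmodule ≃ₗ[ℂ] Y.toSubmodule, Φ X.unit = Y.unit ∧ IsBiLipIsometric X Y Φ ∧
      ∀ n ∈ S, ∀ m ≤ n, IsNPositive m (Y.toSubmodule.subtype ∘ₗ Φ.toLinearMap) ∧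
        IsNPositive m (X.toSubmodule.subtype ∘ₗ Φ.symm.toLinearMap) := by
  obtain ⟨n₀, hn₀⟩ := hS
  let l : Ultrafilter ℕ := Filter.hyperfilter ℕ
  have hl : (l : Filter ℕ) ≤ Filter.atTop := by
    rw [← Nat.cofinite_eq_atTop]
    exact Filter.hyperfilter_le_cofinite
  let G := asymptoticGraph X.toOperatorSystem Y.toOperatorSystem P l
  have hdomX : ∀ x : X.dom, ∃ y : Y.dom, Y.lip y ≤ X.lip x ∧
      ((⟨x, (X.dom_le x x.2).1⟩, ⟨y, (Y.dom_le y y.2).1⟩) : X.toSubmodule × Y.toSubmodule) ∈ G :=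
    exists_dom_mem_asymptoticGraph hl (hS1 n₀ hn₀) (hPX n₀ hn₀) hN hNY hPN
  have hdomY : ∀ y : Y.dom, ∃ x : X.dom, X.lip x ≤ Y.lip y ∧
      ((⟨x, (X.dom_le x x.2).1⟩, ⟨y, (Y.dom_le y y.2).1⟩) : X.toSubmodule × Y.toSubmodule) ∈
        G := by
    intro y
    obtain ⟨x, hx, hG⟩ := exists_dom_mem_asymptoticGraph (P := fun k n ψ φ => P k n φ ψ) hl
      (hS1 n₀ hn₀) (hPY n₀ hn₀) (N := fun k y x => N k x y)
      hN' (fun k y x => hNX k x y)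
      (fun k n ψ φ hφ y x C hC hN => by
        rw [norm_sub_rev]
        exact hPN k n φ ψ hφ x y C hC hN) y
    exact ⟨x, hx, swap_mem_asymptoticGraph.mp hG⟩
  have huY : ∀ {x y y'}, (x, y) ∈ G → (x, y') ∈ G → y = y' := fun h1 h2 =>
    eq_of_mem_asymptoticGraph (hS1 n₀ hn₀) (hPX n₀ hn₀) h1 h2
  have huX : ∀ {x x' y}, (x, y) ∈ G → (x', y) ∈ G → x = x' := fun h1 h2 =>
    eq_of_mem_asymptoticGraph (P := fun k n ψ φ => P k n φ ψ) (hS1 n₀ hn₀) (hPY n₀ hn₀)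
      (swap_mem_asymptoticGraph.mpr h1) (swap_mem_asymptoticGraph.mpr h2)
  have hexX : ∀ x : X.toSubmodule, ∃ y : Y.toSubmodule, (x, y) ∈ G :=
    exists_mem_asymptoticGraph (hS1 n₀ hn₀) (hPX n₀ hn₀) (D := X.dom)
      (fun x hx => (X.dom_le x hx).1) X.dense_dom fun x hx => by
        obtain ⟨y, -, hy⟩ := hdomX ⟨x, hx⟩
        exact ⟨_, hy⟩
  have hexY : ∀ y : Y.toSubmodule, ∃ x : X.toSubmodule, (x, y) ∈ G := fun y => by
    obtain ⟨x, hx⟩ := exists_mem_asymptoticGraph (P := fun k n ψ φ => P k n φ ψ) (l := l)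
      (hS1 n₀ hn₀) (hPY n₀ hn₀) (D := Y.dom) (fun y hy => (Y.dom_le y hy).1) Y.dense_dom
      (fun y hy => by
        obtain ⟨x, -, hx⟩ := hdomY ⟨y, hy⟩
        exact ⟨_, swap_mem_asymptoticGraph.mpr hx⟩) y
    exact ⟨x, swap_mem_asymptoticGraph.mp hx⟩
  obtain ⟨Φ, hΦ⟩ := LinearEquiv.exists_forall_mem_of_graph huY huX hexX hexY
  have hΦ' : ∀ y, (Φ.symm y, y) ∈ G := fun y => by
    have h1 := hΦ (Φ.symm y)
    rwa [Φ.apply_symm_apply] at h1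
  have hlipY : ∀ (x : X.toSubmodule) (hx : (x : A) ∈ X.dom),
      ∃ hy : (Φ x : B) ∈ Y.dom, Y.lip ⟨Φ x, hy⟩ ≤ X.lip ⟨x, hx⟩ := by
    intro x hx
    obtain ⟨y, hy, hG⟩ := hdomX ⟨x, hx⟩
    rw [huY (hΦ x) hG]
    exact ⟨y.2, hy⟩
  have hlipX : ∀ (y : Y.toSubmodule) (hy : (y : B) ∈ Y.dom),
      ∃ hx : (Φ.symm y : A) ∈ X.dom, X.lip ⟨Φ.symm y, hx⟩ ≤ Y.lip ⟨y, hy⟩ := by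
    intro y hy
    obtain ⟨x, hx, hG⟩ := hdomY ⟨y, hy⟩
    rw [huX (hΦ' y) hG]
    exact ⟨x.2, hx⟩
  refine ⟨Φ, huY (hΦ _) unit_mem_asymptoticGraph, ⟨fun x hx => ?_, fun y hy => ?_⟩,
    fun n hn m hm => ⟨fun M hM => ?_, fun M hM => ?_⟩⟩
  · obtain ⟨hy, h1⟩ := hlipY x hx
    obtain ⟨hx', h2⟩ := hlipX (Φ x) hy
    refine ⟨hy, le_antisymm h1 ?_⟩
    have e : (⟨Φ.symm (Φ x), hx'⟩ : X.dom) = ⟨x, hx⟩ :=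
      Subtype.ext (congrArg (Subtype.val : X.toSubmodule → A) (Φ.symm_apply_apply x))
    rwa [e] at h2
  · obtain ⟨hx, h1⟩ := hlipX y hy
    obtain ⟨hy', h2⟩ := hlipY (Φ.symm y) hx
    refine ⟨hx, le_antisymm h1 ?_⟩
    have e : (⟨Φ (Φ.symm y), hy'⟩ : Y.dom) = ⟨y, hy⟩ :=
      Subtype.ext (congrArg (Subtype.val : Y.toSubmodule → B) (Φ.apply_symm_apply y))
    rwa [e] at h2
  · exact toCStarMatrix_nonneg_of_mem_asymptoticGraph hm (hPX n hn) (N := M.map fun x => Φ x)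
      (fun i j => hΦ (M i j)) hM
  · exact toCStarMatrix_nonneg_of_mem_asymptoticGraph (P := fun k n ψ φ => P k n φ ψ) (l := l) hm
      (hPY n hn) (N := M.map fun x => Φ.symm x)
      (fun i j => swap_mem_asymptoticGraph.mpr (hΦ' (M i j))) hM

theorem norm_sub_le_of_lipMetric_le {L : Seminorm ℝ (X.dom.prod Y.dom)} {n : ℕ}
    {φ : UCP X.toOperatorSystem n} {ψ : UCP Y.toOperatorSystem n} {ε : ℝ} (hε : 0 ≤ ε)
    (hd : (UCP.lipMetric (X.toOperatorSystem.prod Y.toOperatorSystem) L n).edist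
      (UCP.inl X.toOperatorSystem Y.toOperatorSystem n φ)
      (UCP.inr X.toOperatorSystem Y.toOperatorSystem n ψ) ≤ ENNReal.ofReal ε)
    (x : X.dom) (y : Y.dom) {C : ℝ} (hC : 0 < C) (hL : L ⟨(x, y), ⟨x.2, y.2⟩⟩ ≤ C) :
    ‖φ.1 ⟨x, (X.dom_le x x.2).1⟩ - ψ.1 ⟨y, (Y.dom_le y y.2).1⟩‖ ≤ C * ε := by
  have h1 : L (C⁻¹ • ⟨(x, y), ⟨x.2, y.2⟩⟩) ≤ 1 := by
    rw [map_smul_eq_mul, Real.norm_of_nonneg (inv_nonneg.mpr hC.le), inv_mul_le_iff₀ hC]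
    simpa using hL
  have h2 := (le_iSup (fun w : {w : (X.toOperatorSystem.prod Y.toOperatorSystem).toSubmodule //
      ∃ hw : (w : A × B) ∈ X.dom.prod Y.dom, L ⟨w, hw⟩ ≤ 1} =>
        ‖(UCP.inl X.toOperatorSystem Y.toOperatorSystem n φ).1 w.1 -
          (UCP.inr X.toOperatorSystem Y.toOperatorSystem n ψ).1 w.1‖ₑ)
      ⟨⟨(C⁻¹ • (x : A), C⁻¹ • (y : B)), (X.dom_le _ (C⁻¹ • x).2).1, (Y.dom_le _ (C⁻¹ • y).2).1⟩,
        ⟨(C⁻¹ • x).2, (C⁻¹ • y).2⟩, h1⟩).trans hd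
  have hx : (⟨C⁻¹ • (x : A), (X.dom_le _ (C⁻¹ • x).2).1⟩ : X.toSubmodule) =
      ((C⁻¹ : ℝ) : ℂ) • ⟨x, (X.dom_le x x.2).1⟩ := Subtype.ext (Complex.coe_smul _ _).symm
  have hy : (⟨C⁻¹ • (y : B), (Y.dom_le _ (C⁻¹ • y).2).1⟩ : Y.toSubmodule) =
      ((C⁻¹ : ℝ) : ℂ) • ⟨y, (Y.dom_le y y.2).1⟩ := Subtype.ext (Complex.coe_smul _ _).symm
  change ‖φ.1 ⟨C⁻¹ • (x : A), (X.dom_le _ (C⁻¹ • x).2).1⟩ -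
    ψ.1 ⟨C⁻¹ • (y : B), (Y.dom_le _ (C⁻¹ • y).2).1⟩‖ₑ ≤ _ at h2
  rw [hx, hy, ← ofReal_norm, ENNReal.ofReal_le_ofReal_iff hε, map_smul, map_smul,
    ← smul_sub, norm_smul, Complex.norm_real, Real.norm_of_nonneg (inv_nonneg.mpr hC.le),
    inv_mul_le_iff₀ hC] at h2
  exact h2

/-- If there are admissible seminorms for which the Hausdorff distances between `UCPₙ(X)` and
`UCPₙ(Y)` are arbitrarily small, uniformly for `n` in a set `S` of positive integers, then there is
a bi-Lip-isometric unital isomorphism that is `m`-positive in both directions for all `m ≤ n`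
with `n` in `S`. -/
theorem exists_equiv_of_forall_ucpHausdorff_lt {S : Set ℕ} (hS : S.Nonempty)
    (hS1 : ∀ n ∈ S, 1 ≤ n)
    (h : ∀ ε : ℝ≥0∞, 0 < ε → ∃ L : Seminorm ℝ (X.dom.prod Y.dom), IsAdmissible X Y L ∧
      ∀ n ∈ S, ucpHausdorff X Y L n < ε) :
    ∃ Φ : X.toSubmodule ≃ₗ[ℂ] Y.toSubmodule, Φ X.unit = Y.unit ∧ IsBiLipIsometric X Y Φ ∧
      ∀ n ∈ S, ∀ m ≤ n, IsNPositive m (Y.toSubmodule.subtype ∘ₗ Φ.toLinearMap) ∧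
        IsNPositive m (X.toSubmodule.subtype ∘ₗ Φ.symm.toLinearMap) := by
  choose L hL hLH using fun k : ℕ => h (ENNReal.ofReal (1 / ((k : ℝ) + 1)))
    (ENNReal.ofReal_pos.mpr (by positivity))
  let N : ℕ → X.dom → Y.dom → ℝ := fun k x y => L k ⟨(x, y), ⟨x.2, y.2⟩⟩
  have hdist : ∀ k n (φ : UCP X.toOperatorSystem n) (ψ : UCP Y.toOperatorSystem n),
      (UCP.lipMetric (X.toOperatorSystem.prod Y.toOperatorSystem) (L k) n).edist
        (UCP.inl X.toOperatorSystem Y.toOperatorSystem n φ)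
        (UCP.inr X.toOperatorSystem Y.toOperatorSystem n ψ) ≤
          ENNReal.ofReal (1 / ((k : ℝ) + 1)) → ∀ (x : X.dom) (y : Y.dom) (C : ℝ), 0 < C →
      N k x y ≤ C → ‖φ.1 ⟨x, (X.dom_le x x.2).1⟩ - ψ.1 ⟨y, (Y.dom_le y y.2).1⟩‖ ≤ C / (k + 1) :=
    fun k n φ ψ hd x y C hC hNC =>
      (norm_sub_le_of_lipMetric_le (by positivity) hd x y hC hNC).trans_eq (mul_one_div _ _)
  refine exists_equiv_of_relations hS hS1 (P := fun k n φ ψ =>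
    (UCP.lipMetric (X.toOperatorSystem.prod Y.toOperatorSystem) (L k) n).edist
      (UCP.inl X.toOperatorSystem Y.toOperatorSystem n φ)
      (UCP.inr X.toOperatorSystem Y.toOperatorSystem n ψ) ≤ ENNReal.ofReal (1 / ((k : ℝ) + 1)))
    (fun n hn k ψ => ?_) (fun n hn k φ => ?_) (N := N) (fun k x c hc => ?_)
    (fun k x y => ((hL k).induces_left x).1 ⟨y, rfl⟩) (fun k y c hc => ?_)
    (fun k x y => ((hL k).induces_right y).1 ⟨x, rfl⟩) hdist
  · let _ := UCP.lipMetric (X.toOperatorSystem.prod Y.toOperatorSystem) (L k) n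
    have h1 := hLH k n hn
    rw [ucpHausdorff, Metric.hausdorffEDist_comm] at h1
    obtain ⟨_, ⟨φ, rfl⟩, h2⟩ :=
      Metric.exists_edist_lt_of_hausdorffEDist_lt (Set.mem_range_self ψ) h1
    rw [edist_comm] at h2
    exact ⟨φ, h2.le⟩
  · let _ := UCP.lipMetric (X.toOperatorSystem.prod Y.toOperatorSystem) (L k) n
    have h1 := hLH k n hn
    rw [ucpHausdorff] at h1
    obtain ⟨_, ⟨ψ, rfl⟩, h2⟩ :=
      Metric.exists_edist_lt_of_hausdorffEDist_lt (Set.mem_range_self φ) h1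
    exact ⟨ψ, h2.le⟩
  · obtain ⟨_, ⟨y, rfl⟩, h1⟩ := (isGLB_lt_iff ((hL k).induces_left x)).mp hc
    exact ⟨y, h1⟩
  · obtain ⟨_, ⟨x, rfl⟩, h1⟩ := (isGLB_lt_iff ((hL k).induces_right y)).mp hc
    exact ⟨x, h1⟩

end Limit

/-! ### Vanishing of the distances -/

theorem IsNPositive.comp {A B C : Type*} [CStarAlgebra A] [PartialOrder A] [StarOrderedRing A]
    [CStarAlgebra B] [PartialOrder B] [StarOrderedRing B] [CStarAlgebra C] [PartialOrder C]
    [StarOrderedRing C] {V : Submodule ℂ A} {W : Submodule ℂ B} {n : ℕ} {ψ : W →ₗ[ℂ] C}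
    {Φ : V →ₗ[ℂ] W} (hψ : IsNPositive n ψ) (hΦ : IsNPositive n (W.subtype ∘ₗ Φ)) :
    IsNPositive n (ψ ∘ₗ Φ) :=
  fun M hM => hψ (M.map fun x => Φ x) (hΦ M hM)

theorem mainTheorem1 {A B : Type*} [CStarAlgebra A] [PartialOrder A] [StarOrderedRing A]
    [CStarAlgebra B] [PartialOrder B] [StarOrderedRing B]
    (X : LipNormedOperatorSystem A) (Y : LipNormedOperatorSystem B) :
    (∀ n : ℕ, 1 ≤ n →
      (nDist n X Y = 0 ↔
        ∃ Φ : X.toSubmodule ≃ₗ[ℂ] Y.toSubmodule,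
          IsUnitalNOrderIso X.toOperatorSystem Y.toOperatorSystem n Φ ∧
          IsBiLipIsometric X Y Φ)) ∧
    (completeDist X Y = 0 ↔
      ∃ Φ : X.toSubmodule ≃ₗ[ℂ] Y.toSubmodule,
        IsUnitalCompleteOrderIso X.toOperatorSystem Y.toOperatorSystem Φ ∧
        IsBiLipIsometric X Y Φ) := by
  refine ⟨fun n hn => ⟨fun h => ?_, ?_⟩, fun h => ?_, ?_⟩
  · obtain ⟨Φ, hu, hbi, hpos⟩ := exists_equiv_of_forall_ucpHausdorff_lt (X := X) (Y := Y)
      (Set.singleton_nonempty n) (by rintro _ rfl; exact hn) fun ε hε => by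
        rw [← h, nDist, iInf_lt_iff] at hε
        obtain ⟨L, hε⟩ := hε
        obtain ⟨hL, hε⟩ := iInf_lt_iff.mp hε
        exact ⟨L, hL, by rintro _ rfl; exact hε⟩
    exact ⟨Φ, ⟨hu, fun m _ hm => hpos n rfl m hm⟩, hbi⟩
  · rintro ⟨Φ, ⟨hu, hpos⟩, hbi⟩
    refine le_antisymm (ENNReal.le_of_forall_pos_le_add fun γ hγ _ => ?_) zero_le
    rw [zero_add, nDist]
    refine (iInf₂_le (graphSeminorm hbi.1 (γ : ℝ))
      (isAdmissible_graphSeminorm hbi hγ hu (hpos 1 le_rfl hn).1)).trans ?_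
    refine (ucpHausdorff_graphSeminorm_le hbi hγ hu (fun φ => ?_) fun ψ => ?_).trans
      ENNReal.ofReal_coe_nnreal.le
    · exact ((φ.2.2 n).comp (hpos n hn le_rfl).2).isCP
    · exact ((ψ.2.2 n).comp (hpos n hn le_rfl).1).isCP
  · obtain ⟨Φ, hu, hbi, hpos⟩ := exists_equiv_of_forall_ucpHausdorff_lt (X := X) (Y := Y)
      (S := {n | 1 ≤ n}) ⟨1, le_refl 1⟩ (fun _ hn => hn) fun ε hε => by
        rw [← h, completeDist, iInf_lt_iff] at hε
        obtain ⟨L, hε⟩ := hε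
        obtain ⟨hL, hε⟩ := iInf_lt_iff.mp hε
        exact ⟨L, hL, fun n hn =>
          (le_iSup₂ (f := fun (n : ℕ) (_ : 1 ≤ n) => ucpHausdorff X Y L n) n hn).trans_lt hε⟩
    have hle : ∀ m : ℕ, m ≤ m + 1 := fun m => m.le_succ
    exact ⟨Φ, ⟨hu, fun m => (hpos (m + 1) m.succ_pos m (hle m)).1,
      fun m => (hpos (m + 1) m.succ_pos m (hle m)).2⟩, hbi⟩
  · rintro ⟨Φ, ⟨hu, hpos, hpos'⟩, hbi⟩
    refine le_antisymm (ENNReal.le_of_forall_pos_le_add fun γ hγ _ => ?_) zero_le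
    rw [zero_add, completeDist]
    refine (iInf₂_le (graphSeminorm hbi.1 (γ : ℝ))
      (isAdmissible_graphSeminorm hbi hγ hu (hpos 1))).trans (iSup₂_le fun n hn => ?_)
    refine (ucpHausdorff_graphSeminorm_le hbi hγ hu (fun φ => ?_) fun ψ => ?_).trans
      ENNReal.ofReal_coe_nnreal.le
    · exact fun m => (φ.2.2 m).comp (hpos' m)
    · exact fun m => (ψ.2.2 m).comp (hpos m)
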